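/- Let $D\ge 2$ and let $f:\mathbb C\to\mathbb C$ be a polynomial of degree $D$ which has exactly one critical point in $\mathbb C$, and suppose that this critical point is periodic under $f$. Extend $f$ to the Riemann sphere $\widehat{\mathbb C}$ by $f(\infty)=\infty$, let $\mathcal C_f\subset\widehat{\mathbb C}$ be its set of critical points (including $\infty$), and let $\mathcal P_f=\bigcup_{n\ge 1}f^{\circ n}(\mathcal C_f)$ be its postcritical set. Let $\mathcal Q(\widehat{\mathbb C})$ be the complex vector space of meromorphic quadratic differentials $q\,(\mathrm dz)^2$ on $\widehat{\mathbb C}$ all of whose poles are simple, and let $\mathcal Q_f\subset\mathcal Q(\widehat{\mathbb C})$ be the subspace of those whose poles lie in $\mathcal P_f$. Let $f_*$ be the Thurston pushforward operator, $f_*\bigl(q\,(\mathrm dz)^2\bigr)=r\,(\mathrm dz)^2$ with $$r(y)=\sum_{x\in f^{-1}(y)}\frac{q(x)}{f'(x)^2}.$$ Then $f_*$ maps $\mathcal Q(\widehat{\mathbb C})$ into itself and $\mathcal Q_f$ into itself. Call a complex number $x\neq0$ an algebraic unit if $x$ and $1/x$ are algebraic integers. Then: 1. If $\lambda\ne0$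 is an eigenvalue of $f_*:\mathcal Q(\widehat{\mathbb C})\to\mathcal Q(\widehat{\mathbb C})$, then $D\lambda$ is an algebraic unit and $\frac1{4D}<|\lambda|<1$. 2. If $\lambda$ is an eigenvalue of $f_*:\mathcal Q_f\to\mathcal Q_f$, then $D\lambda$ is an algebraic unit (in particular $\lambda\neq 0$) and $\frac1{4D}<|\lambda|<1$. 3. If $\lambda\neq0$ is an eigenvalue of the operator induced by $f_*$ on $\mathcal Q(\widehat{\mathbb C})/\mathcal Q_f$, then $D\lambda$ is an algebraic unit and $\frac1{2D}\le|\lambda|<1$. -/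

import Mathlib

open Filter Topology Polynomial

/-! ### Meromorphic quadratic differentials on the Riemann sphere

The Riemann sphere is `OnePoint ℂ`.  A quadratic differential `q (dz)²` is given by its coefficient
`q : ℂ → ℂ` in the coordinate `z`.  In the coordinate `w = 1 / z` near `∞`, one has
`(dz)² = w⁻⁴ (dw)²`, so its coefficient is `w ↦ q (w⁻¹) / w ^ 4`. -/

namespace QuadDiff

/-- The coefficient of `q (dz)²` in the coordinate `w = 1 / z` centred at `∞`. -/
noncomputable def coeffAtInfty (q : ℂ → ℂ) : ℂ → ℂ := fun w => q w⁻¹ / w ^ 4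

/-- `q (dz)²` is meromorphic at a point of the Riemann sphere. -/
def MerAt (q : ℂ → ℂ) (x : OnePoint ℂ) : Prop :=
  OnePoint.elim x (MeromorphicAt (coeffAtInfty q) 0) (fun z => MeromorphicAt q z)

/-- The order of the quadratic differential `q (dz)²` at a point of the Riemann sphere: positive at
zeros, negative at poles, `⊤` if it vanishes identically near the point. -/
noncomputable def ordAt (q : ℂ → ℂ) (x : OnePoint ℂ) : WithTop ℤ :=
  OnePoint.elim x (meromorphicOrderAt (coeffAtInfty q) 0) (fun z => meromorphicOrderAt q z)

/-- `q (dz)²` is a meromorphic quadratic differential on the Riemann sphere, all of whose poles are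
simple and belong to `X`. -/
def HasSimplePolesIn (X : Set (OnePoint ℂ)) (q : ℂ → ℂ) : Prop :=
  ∀ x, MerAt q x ∧ -1 ≤ ordAt q x ∧ (x ∉ X → 0 ≤ ordAt q x)

theorem le_ord_add {f g : ℂ → ℂ} {a : ℂ} {n : WithTop ℤ} (hf : MeromorphicAt f a)
    (hg : MeromorphicAt g a) (h₁ : n ≤ meromorphicOrderAt f a)
    (h₂ : n ≤ meromorphicOrderAt g a) : n ≤ meromorphicOrderAt (f + g) a :=
  (le_min h₁ h₂).trans (meromorphicOrderAt_add hf hg)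

theorem le_ord_smul {f : ℂ → ℂ} {a : ℂ} {n : WithTop ℤ} (c : ℂ) (hf : MeromorphicAt f a)
    (h : n ≤ meromorphicOrderAt f a) : n ≤ meromorphicOrderAt (c • f) a := by
  have hc : AnalyticAt ℂ (fun _ : ℂ => c) a := analyticAt_const
  have e : (c • f) = (fun _ : ℂ => c) * f := by
    ext z; simp
  rw [e, meromorphicOrderAt_mul hc.meromorphicAt hf]
  calc n = 0 + n := (zero_add n).symm
    _ ≤ _ := add_le_add hc.meromorphicOrderAt_nonneg h

theorem mer_smul {f : ℂ → ℂ} {a : ℂ} (c : ℂ) (hf : MeromorphicAt f a) :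
    MeromorphicAt (c • f) a :=
  (MeromorphicAt.const c a).smul hf

theorem coeffAtInfty_add (p q : ℂ → ℂ) :
    coeffAtInfty (p + q) = coeffAtInfty p + coeffAtInfty q := by
  ext w; simp [coeffAtInfty, add_div]

theorem coeffAtInfty_smul (c : ℂ) (q : ℂ → ℂ) :
    coeffAtInfty (c • q) = c • coeffAtInfty q := by
  ext w; simp [coeffAtInfty, mul_div_assoc]

theorem hasSimplePolesIn_zero (X : Set (OnePoint ℂ)) : HasSimplePolesIn X 0 := by
  have h0 : coeffAtInfty 0 = fun _ => (0 : ℂ) := by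
    ext w; simp [coeffAtInfty]
  have hz : (0 : ℂ → ℂ) = fun _ => (0 : ℂ) := rfl
  intro x
  induction x using OnePoint.rec with
  | infty =>
    simp only [MerAt, ordAt, OnePoint.elim_infty, h0, meromorphicOrderAt_const]
    simp [MeromorphicAt.const]
  | coe z =>
    simp only [MerAt, ordAt, OnePoint.elim_some, hz, meromorphicOrderAt_const]
    simp [MeromorphicAt.const]

theorem HasSimplePolesIn.add {X : Set (OnePoint ℂ)} {p q : ℂ → ℂ} (hp : HasSimplePolesIn X p)
    (hq : HasSimplePolesIn X q) : HasSimplePolesIn X (p + q) := by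
  intro x
  obtain ⟨p₁, p₂, p₃⟩ := hp x
  obtain ⟨q₁, q₂, q₃⟩ := hq x
  induction x using OnePoint.rec with
  | infty =>
    simp only [MerAt, ordAt, OnePoint.elim_infty, coeffAtInfty_add] at *
    exact ⟨p₁.add q₁, le_ord_add p₁ q₁ p₂ q₂, fun h => le_ord_add p₁ q₁ (p₃ h) (q₃ h)⟩
  | coe z =>
    simp only [MerAt, ordAt, OnePoint.elim_some] at *
    exact ⟨p₁.add q₁, le_ord_add p₁ q₁ p₂ q₂, fun h => le_ord_add p₁ q₁ (p₃ h) (q₃ h)⟩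

theorem HasSimplePolesIn.smul {X : Set (OnePoint ℂ)} {q : ℂ → ℂ} (c : ℂ)
    (hq : HasSimplePolesIn X q) : HasSimplePolesIn X (c • q) := by
  intro x
  obtain ⟨q₁, q₂, q₃⟩ := hq x
  induction x using OnePoint.rec with
  | infty =>
    simp only [MerAt, ordAt, OnePoint.elim_infty, coeffAtInfty_smul] at *
    exact ⟨mer_smul c q₁, le_ord_smul c q₁ q₂, fun h => le_ord_smul c q₁ (q₃ h)⟩
  | coe z =>
    simp only [MerAt, ordAt, OnePoint.elim_some] at *
    exact ⟨mer_smul c q₁, le_ord_smul c q₁ q₂, fun h => le_ord_smul c q₁ (q₃ h)⟩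

/-- Coefficients `q : ℂ → ℂ` of quadratic differentials `q (dz)²` on the sphere, where two
coefficients are identified if they agree outside a finite set.  Since the sphere is compact, two
meromorphic coefficients represent the same quadratic differential exactly in this case; in
particular the values that Lean functions take at poles are irrelevant. -/
abbrev Coeff : Type := Germ (cofinite : Filter ℂ) ℂ

/-- The space of meromorphic quadratic differentials on the Riemann sphere whose poles are simple
and contained in `X`. -/
def polesIn (X : Set (OnePoint ℂ)) : Submodule ℂ Coeff where
  carrier := {g | ∃ q : ℂ → ℂ, (q : Coeff) = g ∧ HasSimplePolesIn X q}
  zero_mem' := ⟨0, rfl, hasSimplePolesIn_zero X⟩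
  add_mem' := by
    rintro _ _ ⟨p, rfl, hp⟩ ⟨q, rfl, hq⟩
    exact ⟨p + q, rfl, hp.add hq⟩
  smul_mem' := by
    rintro c _ ⟨q, rfl, hq⟩
    exact ⟨c • q, rfl, hq.smul c⟩

/-- `𝒬(Ĉ)`: the space of meromorphic quadratic differentials on the Riemann sphere with at most
simple poles. -/
abbrev sphere : Submodule ℂ Coeff := polesIn Set.univ

/-! ### The Thurston pushforward operator of a polynomial -/

/-- The coefficient of `f_* (q (dz)²)`, namely `y ↦ ∑_{x ∈ f⁻¹(y)} q(x) / f'(x)²`. -/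
noncomputable def pushforwardFun (f : ℂ[X]) (q : ℂ → ℂ) : ℂ → ℂ := fun y =>
  ∑ x ∈ (f - C y).roots.toFinset, q x / (f.derivative.eval x) ^ 2

theorem pushforwardFun_congr (f : ℂ[X]) {p q : ℂ → ℂ} (h : p =ᶠ[cofinite] q) :
    pushforwardFun f p =ᶠ[cofinite] pushforwardFun f q := by
  have hS : {x | p x ≠ q x}.Finite := by
    simpa [EventuallyEq, eventually_cofinite] using h
  have : ((fun x => f.eval x) '' {x | p x ≠ q x}).Finite := hS.image _
  rw [EventuallyEq, eventually_cofinite]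
  refine this.subset ?_
  intro y hy
  by_contra hn
  apply hy
  refine Finset.sum_congr rfl fun x hx => ?_
  have hx' : f.eval x = y := by
    have := (mem_roots'.1 (Multiset.mem_toFinset.1 hx)).2
    simpa [IsRoot, sub_eq_zero] using this
  have : p x = q x := by
    by_contra hne
    exact hn ⟨x, hne, hx'⟩
  rw [this]

/-- The Thurston pushforward operator `f_*` of the polynomial `f`. -/
noncomputable def pushforward (f : ℂ[X]) : Coeff →ₗ[ℂ] Coeff where
  toFun := Germ.map' (pushforwardFun f) (fun _ _ h => pushforwardFun_congr f h)
  map_add' := by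
    intro a b
    refine Germ.inductionOn₂ a b fun p q => ?_
    refine congrArg (fun r : ℂ → ℂ => (r : Coeff)) ?_
    ext y
    simp [pushforwardFun, add_div, Finset.sum_add_distrib]
  map_smul' := by
    intro c a
    refine Germ.inductionOn a fun q => ?_
    refine congrArg (fun r : ℂ → ℂ => (r : Coeff)) ?_
    ext y
    simp [pushforwardFun, mul_div_assoc, Finset.mul_sum]

/-! ### The postcritical set -/

/-- The extension of a nonconstant polynomial to the Riemann sphere, fixing `∞`. -/
noncomputable def sphereMap (f : ℂ[X]) : OnePoint ℂ → OnePoint ℂ :=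
  OnePoint.map (fun z => f.eval z)

/-- The critical points on the Riemann sphere of a nonconstant polynomial: the zeros of `f'`, and
`∞` (where the local degree is the degree of `f`) if the degree is at least `2`. -/
def criticalSet (f : ℂ[X]) : Set (OnePoint ℂ) :=
  {x | OnePoint.elim x (2 ≤ f.natDegree) (fun z => f.derivative.eval z = 0)}

/-- The postcritical set `𝒫_f = ⋃_{n ≥ 1} fⁿ(𝒞_f)`. -/
def postcriticalSet (f : ℂ[X]) : Set (OnePoint ℂ) :=
  ⋃ n : ℕ, ⋃ _ : 1 ≤ n, (sphereMap f)^[n] '' criticalSet f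

/-- `𝒬_f`: the quadratic differentials in `𝒬(Ĉ)` whose poles lie in the postcritical set. -/
abbrev postcritical (f : ℂ[X]) : Submodule ℂ Coeff := polesIn (postcriticalSet f)

end QuadDiff

/-! ### Linear algebra and arithmetic -/

/-- The endomorphism of `W / W'` (with `W'` replaced by `W' ∩ W`) induced by an endomorphism `T` of
the ambient space which preserves both `W` and `W'`. -/
def inducedOnQuotient {V : Type*} [AddCommGroup V] [Module ℂ V] (T : V →ₗ[ℂ] V)
    (W W' : Submodule ℂ V) (hW : ∀ v ∈ W, T v ∈ W) (hW' : ∀ v ∈ W', T v ∈ W') :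
    Module.End ℂ (W ⧸ W'.submoduleOf W) :=
  Submodule.mapQ _ _ (T.restrict hW) (fun v hv => hW' v hv)

/-- `x` is an algebraic unit: `x` and `x⁻¹` are algebraic integers. -/
def IsAlgebraicUnit (x : ℂ) : Prop := x ≠ 0 ∧ IsIntegral ℤ x ∧ IsIntegral ℤ x⁻¹

/-!
A polynomial with a single critical point is `f = α (z - z₀) ^ D + v`. By Liouville's theorem
(`mem_polesIn_iff`), an element of `𝒬(Ĉ)` is a sum `∑ a, ρ a / (z - a)` whose residues satisfy
`∑ a, ρ a = 0` and `∑ a, ρ a * a = 0`. The pushforward of `1 / (z - a)` is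
`(1 / (y - f a) - 1 / (y - v)) / f' a`, so `f_*` becomes the explicit operator `residueMap` on
residues (`pushforward_ofResidues`).

Let `f_* q = ev • q`, possibly only modulo `𝒬_f`. Poles outside the orbit `P` of `v` are permuted by
`f`, and going around a cycle gives `ev ^ m * ∏ f' = 1` (`exists_cycle_of_residueMap_eq`). If all
poles lie in `P`, the residues are determined backwards along `P` by the one at `z₀`, and `∑ ρ = 0`
becomes a polynomial equation for `ev` (`exists_sum_eq_zero_of_residueMap_eq`). At a periodic point
other than `z₀`, the number `s = f' / D` is an algebraic unit with `‖s‖ ≤ 2`: in the normal form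
`z ^ D + c` it is the `(D - 1)`-st power of a periodic point `x`, which is integral since `c` is,
invertible because `x = fⁿ(x) - fⁿ(0)` is divisible by `x ^ D`, and bounded by the escape radius
(`derivative_eq_mul_unit_of_mem_periodicPts`). In terms of `D * ev` the two equations have
coefficients which are products of such `s`, and this gives integrality and the lower bounds.

The upper bound `‖ev‖ < 1` is Thurston's contraction argument: `∫ |f_* q| ≤ ∫ |q|` by a change of
variables along the `D` inverse branches, and equality forces the summands over each fibre to have
the same argument. This fails near a pole `a ≠ z₀`: all poles are periodic, so its rotates around
`z₀`, having the same image, are not poles (`norm_lt_one_of_residueMap_eq`). An eigenvector modulo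
`𝒬_f` is either corrected to an eigenvector in `𝒬(Ĉ)` by an element of the finite-dimensional space
`𝒬_f`, or its eigenvalue already occurs on `𝒬_f` (`exists_correction`).
-/

open Filter Topology Polynomial

namespace QuadDiff

/-! ### Polynomials with a single critical point -/

/-- The polynomial `α (X - z₀) ^ D + v`. -/
noncomputable def unicritical (D : ℕ) (α z₀ v : ℂ) : ℂ[X] := C α * (X - C z₀) ^ D + C v

variable {D : ℕ} {α z₀ v : ℂ}

@[simp] theorem eval_unicritical (z : ℂ) :
    (unicritical D α z₀ v).eval z = α * (z - z₀) ^ D + v := by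
  simp [unicritical]

@[simp] theorem eval_derivative_unicritical (z : ℂ) :
    (unicritical D α z₀ v).derivative.eval z = D * α * (z - z₀) ^ (D - 1) := by
  simp [unicritical, derivative_pow]
  ring

theorem exists_eq_unicritical (hD : 2 ≤ D) {f : ℂ[X]} (hf : f.natDegree = D)
    (hcrit : ∀ z : ℂ, f.derivative.eval z = 0 ↔ z = z₀) :
    ∃ α v : ℂ, α ≠ 0 ∧ f = unicritical D α z₀ v := by
  have hdeg : f.derivative.natDegree = D - 1 := by rw [natDegree_derivative, hf]
  have hne : f.derivative ≠ 0 := by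
    intro h
    rw [h, natDegree_zero] at hdeg
    omega
  have hs : f.derivative.Splits := IsAlgClosed.splits _
  have hr : f.derivative.roots = Multiset.replicate (D - 1) z₀ := by
    rw [Multiset.eq_replicate]
    refine ⟨by rw [← hdeg, hs.natDegree_eq_card_roots], fun b hb => ?_⟩
    exact (hcrit b).1 (mem_roots'.1 hb).2
  have hfac := hs.eq_prod_roots
  rw [hr] at hfac
  simp only [Multiset.map_replicate, Multiset.prod_replicate] at hfac
  have hD0 : (D : ℂ) ≠ 0 := by
    exact_mod_cast (by omega : D ≠ 0)
  have hlc : f.derivative.leadingCoeff ≠ 0 := leadingCoeff_ne_zero.2 hne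
  generalize f.derivative.leadingCoeff = l at hfac hlc
  have hder : (f - C (l / D) * (X - C z₀) ^ D).derivative = 0 := by
    rw [derivative_sub, hfac, derivative_C_mul, derivative_X_sub_C_pow, ← mul_assoc, ← C_mul, div_mul_cancel₀ _ hD0, sub_self]
  have hconst := eq_C_of_natDegree_eq_zero (derivative_eq_zero.1 hder)
  refine ⟨l / D, (f - C (l / D) * (X - C z₀) ^ D).coeff 0, div_ne_zero hlc hD0, ?_⟩
  rw [unicritical, ← hconst]
  ring

/-- A nonempty fibre over a point other than the critical value is an orbit of the rotations
around the critical point. -/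
theorem sum_roots_unicritical {M : Type*} [AddCommMonoid M] (hD : D ≠ 0) (hα : α ≠ 0) {ζ : ℂ}
    (hζ : IsPrimitiveRoot ζ D) {s : ℂ} (hs : s ≠ 0) (g : ℂ → M) :
    ∑ x ∈ (unicritical D α z₀ v - C (α * s ^ D + v)).roots.toFinset, g x =
      ∑ k ∈ Finset.range D, g (z₀ + ζ ^ k * s) := by
  classical
  have hinj : Set.InjOn (fun k => z₀ + ζ ^ k * s) (Finset.range D : Set ℕ) := by
    intro i hi j hj h
    simp only [add_right_inj, mul_left_inj' hs] at h
    exact hζ.pow_inj (by simpa using hi) (by simpa using hj) h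
  have hne : unicritical D α z₀ v - C (α * s ^ D + v) ≠ 0 := by
    intro h
    have := congrArg (eval z₀) h
    simp [hD, hα, hs] at this
  rw [← Finset.sum_image (f := g) hinj]
  congr 1
  ext x
  simp only [Multiset.mem_toFinset, mem_roots hne, IsRoot, eval_sub, eval_unicritical, eval_C,
    Finset.mem_image, Finset.mem_range]
  have : NeZero D := ⟨hD⟩
  constructor
  · intro h
    have h1 : (x - z₀) ^ D = s ^ D := by
      have : α * ((x - z₀) ^ D - s ^ D) = 0 := by linear_combination h
      simpa [hα, sub_eq_zero] using this
    obtain ⟨k, hk, hk'⟩ := hζ.eq_pow_of_pow_eq_one (ξ := (x - z₀) / s) (by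
      rw [div_pow, h1, div_self (pow_ne_zero _ hs)])
    exact ⟨k, hk, by rw [hk']; field_simp; ring⟩
  · rintro ⟨k, -, rfl⟩
    rw [add_sub_cancel_left, mul_pow, ← pow_mul, mul_comm k, pow_mul, hζ.pow_eq_one]
    simp

theorem sum_rotate_pow {D : ℕ} {ζ : ℂ} (hζ : IsPrimitiveRoot ζ D) (n : ℕ) :
    ∑ k ∈ Finset.range D, (ζ ^ k) ^ n = if D ∣ n then (D : ℂ) else 0 := by
  simp_rw [← pow_mul, mul_comm _ n, pow_mul]
  split_ifs with h
  · simp [(hζ.pow_eq_one_iff_dvd n).2 h]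
  · have h1 : ζ ^ n ≠ 1 := fun h' => h ((hζ.pow_eq_one_iff_dvd n).1 h')
    rw [geom_sum_eq h1, ← pow_mul, mul_comm, pow_mul, hζ.pow_eq_one]
    simp

/-- Expanding `(t - b)⁻¹` as a geometric sum over `t ^ D - b ^ D`, where `t = ζ ^ k * s`, the sum
over `k` kills every power of `t` whose exponent is not divisible by `D`; one term is left. -/
theorem sum_rotate_inv_sub (hD : 2 ≤ D) {ζ : ℂ} (hζ : IsPrimitiveRoot ζ D) {s b : ℂ} (hs : s ≠ 0)
    (hb : s ^ D ≠ b ^ D) :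
    ∑ k ∈ Finset.range D, (ζ ^ k * s - b)⁻¹ / (ζ ^ k * s) ^ (2 * (D - 1)) =
      D * b / ((s ^ D - b ^ D) * s ^ D) := by
  have hb' : s ^ D - b ^ D ≠ 0 := sub_ne_zero.2 hb
  have hz : ζ ≠ 0 := hζ.ne_zero (by omega)
  have hsD : s ^ D ≠ 0 := pow_ne_zero _ hs
  have term : ∀ k ∈ Finset.range D, (ζ ^ k * s - b)⁻¹ / (ζ ^ k * s) ^ (2 * (D - 1)) =
      ((s ^ D - b ^ D) * s ^ D * s ^ D)⁻¹ *
        ∑ j ∈ Finset.range D, (ζ ^ k) ^ (j + 2) * (s ^ (j + 2) * b ^ (D - 1 - j)) := by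
    intro k _
    set t := ζ ^ k * s with ht
    have ht0 : t ≠ 0 := mul_ne_zero (pow_ne_zero _ hz) hs
    have htD : t ^ D = s ^ D := by
      rw [ht, mul_pow, ← pow_mul, mul_comm k, pow_mul, hζ.pow_eq_one]; simp
    have htb : t - b ≠ 0 := by
      intro h
      rw [sub_eq_zero] at h
      exact hb (by rw [← htD, h])
    have hgeom := (Commute.all t b).geom_sum₂_mul D
    have h2 : t ^ (2 * (D - 1)) * t ^ 2 = s ^ D * s ^ D := by
      rw [← pow_add, show 2 * (D - 1) + 2 = D + D by omega, pow_add, htD]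
    have e : ∑ j ∈ Finset.range D, (ζ ^ k) ^ (j + 2) * (s ^ (j + 2) * b ^ (D - 1 - j)) =
        t ^ 2 * ∑ j ∈ Finset.range D, t ^ j * b ^ (D - 1 - j) := by
      rw [Finset.mul_sum]
      refine Finset.sum_congr rfl fun j _ => ?_
      rw [ht]; ring
    rw [htD] at hgeom
    rw [e, mul_assoc (s ^ D - b ^ D), ← h2, ← hgeom]
    have hG : ∑ j ∈ Finset.range D, t ^ j * b ^ (D - 1 - j) ≠ 0 := by
      intro h0
      rw [h0, zero_mul] at hgeom
      exact hb' hgeom.symm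
    generalize ∑ j ∈ Finset.range D, t ^ j * b ^ (D - 1 - j) = G at hG
    field_simp
  rw [Finset.sum_congr rfl term, ← Finset.mul_sum, Finset.sum_comm]
  simp_rw [← Finset.sum_mul, sum_rotate_pow hζ]
  rw [Finset.sum_eq_single (D - 2)]
  · rw [show D - 2 + 2 = D by omega, show D - 1 - (D - 2) = 1 by omega]
    simp
    field_simp
  · intro j hj hne
    rw [Finset.mem_range] at hj
    rw [if_neg, zero_mul]
    rintro ⟨m, hm⟩
    have : m = 1 := by
      rcases m with _ | _ | m
      · omega
      · rfl
      · exfalso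
        nlinarith
    subst this
    omega
  · intro h
    exact absurd (Finset.mem_range.2 (by omega)) h

theorem exists_pow_eq_of_ne (hD : D ≠ 0) (hα : α ≠ 0) {y : ℂ} (hy : y ≠ v) :
    ∃ s : ℂ, s ≠ 0 ∧ y = α * s ^ D + v := by
  obtain ⟨s, hs⟩ := IsAlgClosed.exists_pow_nat_eq ((y - v) / α) (Nat.pos_of_ne_zero hD)
  refine ⟨s, ?_, by rw [hs]; field_simp; ring⟩
  rintro rfl
  rw [zero_pow hD, eq_comm, div_eq_zero_iff, sub_eq_zero] at hs
  tauto

/-- The pushforward of `(z - a)⁻¹ (dz)²`. If `a = z₀` the right-hand side is `0`, by the convention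
`0⁻¹ = 0`, and so is the pushforward. -/
theorem pushforwardFun_inv_sub (hD : 2 ≤ D) (hα : α ≠ 0) (a : ℂ) {y : ℂ} (hy : y ≠ v)
    (hya : y ≠ (unicritical D α z₀ v).eval a) :
    pushforwardFun (unicritical D α z₀ v) (fun z => (z - a)⁻¹) y =
      ((unicritical D α z₀ v).derivative.eval a)⁻¹ *
        ((y - (unicritical D α z₀ v).eval a)⁻¹ - (y - v)⁻¹) := by
  obtain ⟨s, hs, rfl⟩ := exists_pow_eq_of_ne (D := D) (by omega) hα hy
  have hζ := Complex.isPrimitiveRoot_exp D (by omega)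
  have hb : s ^ D ≠ (a - z₀) ^ D := by
    intro h
    exact hya (by simp [h])
  have hD0 : (D : ℂ) ≠ 0 := by exact_mod_cast (by omega : D ≠ 0)
  rw [pushforwardFun, sum_roots_unicritical (by omega) hα hζ hs
    (fun x => (x - a)⁻¹ / ((unicritical D α z₀ v).derivative.eval x) ^ 2)]
  have h := sum_rotate_inv_sub hD hζ hs hb
  simp only [eval_derivative_unicritical, eval_unicritical, add_sub_cancel_left, add_sub_cancel_right]
  set ζ := Complex.exp (2 * Real.pi * Complex.I / D)
  have e : ∀ k ∈ Finset.range D, (z₀ + ζ ^ k * s - a)⁻¹ / (D * α * (ζ ^ k * s) ^ (D - 1)) ^ 2 =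
      ((D * α) ^ 2)⁻¹ * ((ζ ^ k * s - (a - z₀))⁻¹ / (ζ ^ k * s) ^ (2 * (D - 1))) := by
    intro k _
    rw [show z₀ + ζ ^ k * s - a = ζ ^ k * s - (a - z₀) by ring, mul_pow (D * α : ℂ), ← pow_mul,
      mul_comm (D - 1) 2]
    rw [div_eq_mul_inv, div_eq_mul_inv, mul_inv]
    ring
  rw [Finset.sum_congr rfl e, ← Finset.mul_sum, h]
  have hsub : α * s ^ D + v - (α * (a - z₀) ^ D + v) = α * (s ^ D - (a - z₀) ^ D) := by ring
  rw [hsub]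
  have hb' : s ^ D - (a - z₀) ^ D ≠ 0 := sub_ne_zero.2 hb
  have hsD : s ^ D ≠ 0 := pow_ne_zero _ hs
  by_cases ha : a - z₀ = 0
  · simp [ha, show D - 1 ≠ 0 by omega]
  · have hp : (a - z₀) ^ D = (a - z₀) ^ (D - 1) * (a - z₀) := by
      rw [← pow_succ]; congr 1; omega
    have ha' : (a - z₀) ^ (D - 1) ≠ 0 := pow_ne_zero _ ha
    have e2 : (α * (s ^ D - (a - z₀) ^ D))⁻¹ - (α * s ^ D)⁻¹ =
        (a - z₀) ^ (D - 1) * (a - z₀) * (α * (s ^ D - (a - z₀) ^ D) * s ^ D)⁻¹ := by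
      rw [← hp]
      field_simp
      ring
    rw [e2]
    field_simp

end QuadDiff

namespace QuadDiff

/-! ### Simple poles and partial fractions -/

/-- The coefficient `z ↦ ∑ a, ρ a / (z - a)` with simple poles and residue `ρ a` at `a`. -/
noncomputable def ofResidues : (ℂ →₀ ℂ) →ₗ[ℂ] ℂ → ℂ :=
  Finsupp.linearCombination ℂ fun a z => (z - a)⁻¹

/-- Finitely supported families of residues at points of `X`, subject to the two linear conditions
`∑ a, ρ a = 0` and `∑ a, ρ a * a = 0`, which say that `∑ a, ρ a / (z - a) = O(z⁻³)` at `∞`, that is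
to say that the quadratic differential has at most a simple pole at `∞`. -/
noncomputable def residues (X : Set ℂ) : Submodule ℂ (ℂ →₀ ℂ) :=
  Finsupp.supported ℂ ℂ X ⊓ (LinearMap.ker (Finsupp.linearCombination ℂ fun _ : ℂ => (1 : ℂ)) ⊓
    LinearMap.ker (Finsupp.linearCombination ℂ fun a : ℂ => a))

theorem ofResidues_apply (ρ : ℂ →₀ ℂ) (z : ℂ) :
    ofResidues ρ z = ∑ a ∈ ρ.support, ρ a * (z - a)⁻¹ := by
  simp [ofResidues, Finsupp.linearCombination_apply, Finsupp.sum]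

theorem mem_residues {X : Set ℂ} {ρ : ℂ →₀ ℂ} : ρ ∈ residues X ↔
    (∀ a, ρ a ≠ 0 → a ∈ X) ∧ ∑ a ∈ ρ.support, ρ a = 0 ∧ ∑ a ∈ ρ.support, ρ a * a = 0 := by
  simp [residues, Finsupp.mem_supported, Finsupp.linearCombination_apply, Finsupp.sum,
    Set.subset_def]

theorem analyticAt_ofResidues {ρ : ℂ →₀ ℂ} {z : ℂ} (hz : ρ z = 0) :
    AnalyticAt ℂ (ofResidues ρ) z := by
  have : ofResidues ρ = fun z => ∑ a ∈ ρ.support, ρ a * (z - a)⁻¹ :=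
    funext (ofResidues_apply ρ)
  rw [this]
  refine Finset.analyticAt_fun_sum _ fun a ha => ?_
  refine analyticAt_const.mul ((analyticAt_id.sub analyticAt_const).inv ?_)
  intro h
  rw [Finsupp.mem_support_iff] at ha
  have : z = a := sub_eq_zero.1 h
  exact ha (this ▸ hz)

theorem ofResidues_eq_add (ρ : ℂ →₀ ℂ) (a z : ℂ) :
    ofResidues ρ z = ρ a * (z - a)⁻¹ + ofResidues (ρ.erase a) z := by
  conv_lhs => rw [← Finsupp.single_add_erase a ρ, map_add]
  simp [ofResidues]

theorem tendsto_sub_mul_ofResidues (ρ : ℂ →₀ ℂ) (a : ℂ) :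
    Tendsto (fun z => (z - a) * ofResidues ρ z) (𝓝[≠] a) (𝓝 (ρ a)) := by
  have h1 : Tendsto (fun z => ρ a + (z - a) * ofResidues (ρ.erase a) z) (𝓝 a)
      (𝓝 (ρ a + (a - a) * ofResidues (ρ.erase a) a)) := by
    have := (analyticAt_ofResidues (ρ := ρ.erase a) (z := a) (by simp)).continuousAt.tendsto
    exact tendsto_const_nhds.add ((tendsto_id.sub tendsto_const_nhds).mul this)
  simp only [sub_self, zero_mul, add_zero] at h1
  refine (h1.mono_left nhdsWithin_le_nhds).congr' ?_
  filter_upwards [self_mem_nhdsWithin] with z hz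
  have : z - a ≠ 0 := sub_ne_zero.2 hz
  rw [ofResidues_eq_add ρ a z]
  field_simp

theorem nhdsNE_le_cofinite (a : ℂ) : 𝓝[≠] a ≤ cofinite := by
  intro s hs
  have h : sᶜ.Finite := hs
  have h2 : ((sᶜ \ {a}) : Set ℂ)ᶜ ∈ 𝓝 a :=
    (h.subset Set.sdiff_subset).isClosed.isOpen_compl.mem_nhds (by simp)
  filter_upwards [mem_nhdsWithin_of_mem_nhds h2, self_mem_nhdsWithin] with z hz hza
  by_contra hzs
  exact hz ⟨hzs, hza⟩

theorem eq_zero_of_ofResidues {ρ : ℂ →₀ ℂ} (h : ofResidues ρ =ᶠ[cofinite] 0) : ρ = 0 := by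
  ext a
  refine tendsto_nhds_unique (tendsto_sub_mul_ofResidues ρ a) ?_
  refine tendsto_const_nhds.congr' ?_
  filter_upwards [nhdsNE_le_cofinite a h] with z hz
  simp [hz]

theorem meromorphicAt_ofResidues (ρ : ℂ →₀ ℂ) (z : ℂ) : MeromorphicAt (ofResidues ρ) z := by
  have : ofResidues ρ = fun z => ∑ a ∈ ρ.support, ρ a * (z - a)⁻¹ :=
    funext (ofResidues_apply ρ)
  rw [this]
  refine MeromorphicAt.fun_sum fun a => ?_
  fun_prop

theorem order_sub_mul {f : ℂ → ℂ} {x : ℂ} (hf : MeromorphicAt f x) :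
    meromorphicOrderAt (fun z => (z - x) * f z) x = 1 + meromorphicOrderAt f x := by
  have h := meromorphicOrderAt_mul (f := fun z => z - x)
    ((MeromorphicAt.id x).sub (MeromorphicAt.const x x)) hf
  rw [meromorphicOrderAt_id_sub_const] at h
  exact h

theorem meromorphicAt_sub_mul {f : ℂ → ℂ} {x : ℂ} (hf : MeromorphicAt f x) :
    MeromorphicAt (fun z => (z - x) * f z) x :=
  ((MeromorphicAt.id x).sub (MeromorphicAt.const x x)).mul hf

theorem neg_one_le_iff_zero_le_one_add (n : WithTop ℤ) : -1 ≤ n ↔ 0 ≤ 1 + n := by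
  induction n using WithTop.recTopCoe with
  | top => simp
  | coe n =>
    rw [show (-1 : WithTop ℤ) = ((-1 : ℤ) : WithTop ℤ) by rfl,
      show (1 : WithTop ℤ) = ((1 : ℤ) : WithTop ℤ) by rfl,
      show (0 : WithTop ℤ) = ((0 : ℤ) : WithTop ℤ) by rfl, ← WithTop.coe_add]
    simp only [WithTop.coe_le_coe]
    omega

theorem zero_le_iff_zero_lt_one_add (n : WithTop ℤ) : 0 ≤ n ↔ 0 < 1 + n := by
  induction n using WithTop.recTopCoe with
  | top => simp
  | coe n =>
    rw [show (1 : WithTop ℤ) = ((1 : ℤ) : WithTop ℤ) by rfl,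
      show (0 : WithTop ℤ) = ((0 : ℤ) : WithTop ℤ) by rfl, ← WithTop.coe_add]
    simp only [WithTop.coe_le_coe, WithTop.coe_lt_coe]
    omega

theorem neg_one_le_order_iff {f : ℂ → ℂ} {x : ℂ} (hf : MeromorphicAt f x) :
    -1 ≤ meromorphicOrderAt f x ↔ ∃ c, Tendsto (fun z => (z - x) * f z) (𝓝[≠] x) (𝓝 c) := by
  rw [tendsto_nhds_iff_meromorphicOrderAt_nonneg (meromorphicAt_sub_mul hf), order_sub_mul hf,
    neg_one_le_iff_zero_le_one_add]

theorem zero_le_order_iff {f : ℂ → ℂ} {x : ℂ} (hf : MeromorphicAt f x) :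
    0 ≤ meromorphicOrderAt f x ↔ Tendsto (fun z => (z - x) * f z) (𝓝[≠] x) (𝓝 0) := by
  rw [tendsto_zero_iff_meromorphicOrderAt_pos (meromorphicAt_sub_mul hf), order_sub_mul hf,
    zero_le_iff_zero_lt_one_add]

theorem inv_sub_expansion {a w : ℂ} (hw : w ≠ 0) (hwa : 1 - a * w ≠ 0) :
    w ^ 2 * (w * ((w⁻¹ - a)⁻¹ / w ^ 4)) = 1 + a * w + w ^ 2 * (a ^ 2 * (1 - a * w)⁻¹) := by
  have h1 : w⁻¹ - a = (1 - a * w) / w := by field_simp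
  have h2 : w ^ 2 * (w * ((w⁻¹ - a)⁻¹ / w ^ 4)) = (1 - a * w)⁻¹ := by
    rw [h1, inv_div]
    generalize (1 - a * w) = u
    field_simp
  rw [h2]
  linear_combination (1 + a * w) * mul_inv_cancel₀ hwa

theorem eventually_one_sub_mul_ne_zero (S : Finset ℂ) :
    ∀ᶠ w in 𝓝 (0 : ℂ), ∀ a ∈ S, 1 - a * w ≠ 0 := by
  rw [Filter.eventually_all_finset]
  intro a _
  have : ContinuousAt (fun w : ℂ => 1 - a * w) 0 := by fun_prop
  exact this.eventually_ne (by simp)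

/-- The Laurent expansion at `∞`: the first two coefficients are the two sums in the definition of
`residues`. -/
theorem coeffAtInfty_expansion (ρ : ℂ →₀ ℂ) :
    ∃ H : ℂ → ℂ, AnalyticAt ℂ H 0 ∧ ∀ᶠ w in 𝓝[≠] (0 : ℂ),
      w ^ 2 * (w * coeffAtInfty (ofResidues ρ) w) =
        ∑ a ∈ ρ.support, ρ a + (∑ a ∈ ρ.support, ρ a * a) * w + w ^ 2 * H w := by
  refine ⟨fun w => ∑ a ∈ ρ.support, ρ a * (a ^ 2 * (1 - a * w)⁻¹), ?_, ?_⟩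
  · refine Finset.analyticAt_fun_sum _ fun a _ => analyticAt_const.mul (analyticAt_const.mul ?_)
    exact (analyticAt_const.sub (analyticAt_const.mul analyticAt_id)).inv (by simp)
  · filter_upwards [self_mem_nhdsWithin,
      mem_nhdsWithin_of_mem_nhds (eventually_one_sub_mul_ne_zero ρ.support)] with w hw hwa
    rw [coeffAtInfty, ofResidues_apply, Finset.sum_div, Finset.mul_sum, Finset.mul_sum,
      Finset.sum_mul, Finset.mul_sum, ← Finset.sum_add_distrib, ← Finset.sum_add_distrib]
    refine Finset.sum_congr rfl fun a ha => ?_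
    linear_combination ρ a * inv_sub_expansion hw (hwa a ha)

theorem meromorphicAt_coeffAtInfty_ofResidues (ρ : ℂ →₀ ℂ) :
    MeromorphicAt (coeffAtInfty (ofResidues ρ)) 0 := by
  have : coeffAtInfty (ofResidues ρ) =
      fun w => (∑ a ∈ ρ.support, ρ a * (w⁻¹ - a)⁻¹) / w ^ 4 := by
    ext w
    rw [coeffAtInfty, ofResidues_apply]
  rw [this]
  refine MeromorphicAt.fun_div (MeromorphicAt.fun_sum fun a => ?_) (by fun_prop)
  fun_prop

theorem hasSimplePolesIn_ofResidues {X : Set (OnePoint ℂ)} (hX : OnePoint.infty ∈ X) {ρ : ℂ →₀ ℂ}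
    (hρ : ρ ∈ residues {a | (a : OnePoint ℂ) ∈ X}) : HasSimplePolesIn X (ofResidues ρ) := by
  rw [mem_residues] at hρ
  obtain ⟨hsupp, h0, h1⟩ := hρ
  intro x
  induction x using OnePoint.rec with
  | infty =>
    simp only [MerAt, ordAt, OnePoint.elim_infty]
    refine ⟨meromorphicAt_coeffAtInfty_ofResidues ρ, ?_, fun h => absurd hX h⟩
    rw [neg_one_le_order_iff (meromorphicAt_coeffAtInfty_ofResidues ρ)]
    obtain ⟨H, hH, hev⟩ := coeffAtInfty_expansion ρ
    refine ⟨H 0, (hH.continuousAt.tendsto.mono_left nhdsWithin_le_nhds).congr' ?_⟩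
    filter_upwards [hev, self_mem_nhdsWithin] with w hw hw0
    rw [h0, h1, zero_mul, zero_add, zero_add] at hw
    rw [sub_zero, mul_left_cancel₀ (pow_ne_zero 2 hw0) hw]
  | coe z =>
    simp only [MerAt, ordAt, OnePoint.elim_some]
    refine ⟨meromorphicAt_ofResidues ρ z, ?_, fun h => ?_⟩
    · rw [neg_one_le_order_iff (meromorphicAt_ofResidues ρ z)]
      exact ⟨_, tendsto_sub_mul_ofResidues ρ z⟩
    · rw [zero_le_order_iff (meromorphicAt_ofResidues ρ z)]
      have : ρ z = 0 := by
        by_contra hne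
        exact h (hsupp z hne)
      simpa [this] using tendsto_sub_mul_ofResidues ρ z

/-- A meromorphic function on the sphere without poles in `ℂ` which vanishes at `∞` is zero, by
Liouville's theorem. The function is only controlled up to its values on a discrete set, whence the
passage to its normal form. -/
theorem eq_zero_of_order_nonneg {r : ℂ → ℂ} (hr : ∀ z, MeromorphicAt r z)
    (hord : ∀ z, 0 ≤ meromorphicOrderAt r z) (hinf : Tendsto r (Bornology.cobounded ℂ) (𝓝 0))
    (han : ∀ᶠ z in cofinite, AnalyticAt ℂ r z) : r =ᶠ[cofinite] 0 := by
  have hmer : MeromorphicOn r Set.univ := fun z _ => hr z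
  set R := toMeromorphicNFOn r Set.univ with hR
  have hRan : ∀ z, AnalyticAt ℂ R z := by
    intro z
    have hnf : MeromorphicNFAt R z := meromorphicNFOn_toMeromorphicNFOn r Set.univ (Set.mem_univ z)
    rw [← hnf.meromorphicOrderAt_nonneg_iff_analyticAt,
      meromorphicOrderAt_toMeromorphicNFOn hmer (Set.mem_univ z)]
    exact hord z
  have heq : R =ᶠ[cofinite] r := by
    filter_upwards [han] with z hz
    refine tendsto_nhds_unique
      ((hRan z).continuousAt.tendsto.mono_left (nhdsWithin_le_nhds (s := {z}ᶜ))) ?_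
    refine (hz.continuousAt.tendsto.mono_left nhdsWithin_le_nhds).congr' ?_
    exact (hmer.toMeromorphicNFOn_eq_self_on_nhdsNE (Set.mem_univ z)).symm
  have hRdiff : Differentiable ℂ R := fun z => (hRan z).differentiableAt
  have hRinf : Tendsto R (cocompact ℂ) (𝓝 0) := by
    rw [← Metric.cobounded_eq_cocompact]
    exact hinf.congr' (heq.symm.filter_mono (Bornology.le_cofinite ℂ))
  filter_upwards [heq] with z hz
  rw [← hz, hRdiff.apply_eq_of_tendsto_cocompact z hRinf]
  rfl

theorem finite_not_analyticAt {q : ℂ → ℂ} (hq : ∀ z, MeromorphicAt q z)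
    (hinf : MeromorphicAt (coeffAtInfty q) 0) : {z | ¬ AnalyticAt ℂ q z}.Finite := by
  have h1 : ∀ᶠ z in Bornology.cobounded ℂ, AnalyticAt ℂ q z := by
    have h2 := tendsto_inv₀_cobounded'.eventually hinf.eventually_analyticAt
    filter_upwards [h2, Bornology.le_cofinite ℂ (Set.finite_singleton (0 : ℂ)).compl_mem_cofinite]
      with z hz hz0
    have hz0' : z ≠ 0 := hz0
    have h3 : AnalyticAt ℂ (fun z => coeffAtInfty q z⁻¹ * z⁻¹ ^ 4) z :=
      (hz.comp (analyticAt_id.inv hz0')).mul ((analyticAt_id.inv hz0').pow 4)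
    refine h3.congr ?_
    filter_upwards [isOpen_ne.mem_nhds hz0'] with x hx
    simp only [coeffAtInfty, inv_inv]
    field_simp
  obtain ⟨r, hr⟩ := (Metric.isBounded_iff_subset_closedBall (0 : ℂ)).1
    (show Bornology.IsBounded {z | ¬ AnalyticAt ℂ q z} by
      rw [Bornology.isBounded_def]
      filter_upwards [h1] with z hz
      simpa using hz)
  by_contra hinfinite
  obtain ⟨x, -, hx⟩ := Set.Infinite.exists_accPt_of_subset_isCompact hinfinite
    (isCompact_closedBall 0 r) hr
  rw [accPt_iff_frequently] at hx
  have := (hq x).eventually_analyticAt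
  rw [eventually_nhdsWithin_iff] at this
  obtain ⟨y, ⟨hy, hy'⟩, hy''⟩ := (hx.and_eventually this).exists
  exact hy' (hy'' hy)

theorem tendsto_inv_sub_cobounded (a : ℂ) :
    Tendsto (fun z : ℂ => (z - a)⁻¹) (Bornology.cobounded ℂ) (𝓝 0) := by
  refine tendsto_inv₀_cobounded.comp ?_
  simp [sub_eq_add_neg]

theorem tendsto_ofResidues_cobounded (ρ : ℂ →₀ ℂ) :
    Tendsto (ofResidues ρ) (Bornology.cobounded ℂ) (𝓝 0) := by
  have : ofResidues ρ = fun z => ∑ a ∈ ρ.support, ρ a * (z - a)⁻¹ :=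
    funext (ofResidues_apply ρ)
  rw [this]
  have h := tendsto_finsetSum ρ.support fun a _ =>
    (tendsto_inv_sub_cobounded a).const_mul (ρ a)
  simpa using h

/-- The converse of `hasSimplePolesIn_ofResidues`: subtracting the principal parts leaves an entire
function that vanishes at `∞`. -/
theorem HasSimplePolesIn.exists_residues {X : Set (OnePoint ℂ)} {q : ℂ → ℂ}
    (hq : HasSimplePolesIn X q) :
    ∃ ρ ∈ residues {a | (a : OnePoint ℂ) ∈ X}, ofResidues ρ =ᶠ[cofinite] q := by
  have hmer : ∀ z, MeromorphicAt q z := fun z => (hq z).1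
  have hmi : MeromorphicAt (coeffAtInfty q) 0 := (hq OnePoint.infty).1
  have hfin := finite_not_analyticAt hmer hmi
  have hlim : ∀ z, ∃ c, Tendsto (fun x => (x - z) * q x) (𝓝[≠] z) (𝓝 c) := fun z =>
    (neg_one_le_order_iff (hmer z)).1 (hq z).2.1
  choose c hc using hlim
  have hc0 : ∀ z, 0 ≤ meromorphicOrderAt q z → c z = 0 := fun z hz =>
    tendsto_nhds_unique (hc z) ((zero_le_order_iff (hmer z)).1 hz)
  obtain ⟨l, hl⟩ := (neg_one_le_order_iff hmi).1 (hq OnePoint.infty).2.1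
  simp only [sub_zero] at hl
  let ρ : ℂ →₀ ℂ := Finsupp.onFinset hfin.toFinset c fun z hz => by
    rw [Set.Finite.mem_toFinset]
    exact fun h => hz (hc0 z h.meromorphicOrderAt_nonneg)
  have hρ : ∀ z, ρ z = c z := fun z => rfl
  have hρfin : ∀ᶠ z in cofinite, ρ z = 0 := by
    refine (ρ.support.finite_toSet).subset fun z hz => ?_
    simpa using hz
  have hqinf : Tendsto q (Bornology.cobounded ℂ) (𝓝 0) := by
    have h1 : Tendsto (fun w : ℂ => w ^ 3 * (w * coeffAtInfty q w)) (𝓝[≠] 0) (𝓝 (0 ^ 3 * l)) :=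
      ((tendsto_id.mono_left nhdsWithin_le_nhds).pow 3).mul hl
    rw [zero_pow three_ne_zero, zero_mul] at h1
    refine (h1.comp tendsto_inv₀_cobounded').congr' ?_
    filter_upwards [Bornology.le_cofinite ℂ (Set.finite_singleton (0 : ℂ)).compl_mem_cofinite]
      with z hz
    have hz0 : z ≠ 0 := hz
    simp only [Function.comp, coeffAtInfty, inv_inv]
    field_simp
  have heq : q - ofResidues ρ =ᶠ[cofinite] 0 := by
    refine eq_zero_of_order_nonneg (fun z => (hmer z).sub (meromorphicAt_ofResidues ρ z))
      (fun z => ?_) ?_ ?_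
    · rw [zero_le_order_iff ((hmer z).sub (meromorphicAt_ofResidues ρ z))]
      have h := (hc z).sub (tendsto_sub_mul_ofResidues ρ z)
      rw [hρ, sub_self] at h
      refine h.congr fun x => ?_
      simp [mul_sub]
    · have h := hqinf.sub (tendsto_ofResidues_cobounded ρ)
      rw [sub_zero] at h
      exact h
    · have h1 : ∀ᶠ z in cofinite, AnalyticAt ℂ q z := hfin
      filter_upwards [hρfin, h1] with z hz hz'
      exact hz'.sub (analyticAt_ofResidues hz)
  have heq' : ofResidues ρ =ᶠ[cofinite] q := by
    filter_upwards [heq] with z hz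
    exact (sub_eq_zero.1 hz).symm
  refine ⟨ρ, ?_, heq'⟩
  rw [mem_residues]
  obtain ⟨H, hH, hev⟩ := coeffAtInfty_expansion ρ
  have hl' : Tendsto (fun w => w * coeffAtInfty (ofResidues ρ) w) (𝓝[≠] 0) (𝓝 l) := by
    refine hl.congr' ?_
    filter_upwards [(tendsto_inv₀_nhdsNE_zero.mono_right (Bornology.le_cofinite ℂ)).eventually heq']
      with w hw
    rw [coeffAtInfty, coeffAtInfty, hw]
  have hw : Tendsto (fun w : ℂ => w) (𝓝[≠] 0) (𝓝 0) := nhdsWithin_le_nhds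
  have hHt : Tendsto H (𝓝[≠] 0) (𝓝 (H 0)) := hH.continuousAt.tendsto.mono_left nhdsWithin_le_nhds
  have hS0 : ∑ a ∈ ρ.support, ρ a = 0 := by
    have h1 := ((hw.pow 2).mul hl').congr' hev
    have h2 := ((tendsto_const_nhds (x := ∑ a ∈ ρ.support, ρ a)).add
      (hw.const_mul (∑ a ∈ ρ.support, ρ a * a))).add ((hw.pow 2).mul hHt)
    simpa using tendsto_nhds_unique h2 h1
  refine ⟨fun a ha => ?_, hS0, ?_⟩
  · by_contra hX
    exact ha (hc0 a ((hq a).2.2 hX))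
  · have h2 := (tendsto_const_nhds (x := ∑ a ∈ ρ.support, ρ a * a)).add (hw.mul hHt)
    have h1 : Tendsto (fun w => ∑ a ∈ ρ.support, ρ a * a + w * H w) (𝓝[≠] 0) (𝓝 (0 * l)) := by
      refine (hw.mul hl').congr' ?_
      filter_upwards [hev, self_mem_nhdsWithin] with w hw hw0
      rw [hS0] at hw
      have hw0' : w ≠ 0 := hw0
      refine mul_left_cancel₀ hw0' ?_
      linear_combination hw
    simpa using tendsto_nhds_unique h2 h1

theorem mem_polesIn_iff {X : Set (OnePoint ℂ)} (hX : OnePoint.infty ∈ X) {g : Coeff} :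
    g ∈ polesIn X ↔
      ∃ ρ ∈ residues {a | (a : OnePoint ℂ) ∈ X}, ((ofResidues ρ : ℂ → ℂ) : Coeff) = g := by
  constructor
  · rintro ⟨q, rfl, hq⟩
    obtain ⟨ρ, hρ, h⟩ := hq.exists_residues
    exact ⟨ρ, hρ, Germ.coe_eq.2 h⟩
  · rintro ⟨ρ, hρ, rfl⟩
    exact ⟨_, rfl, hasSimplePolesIn_ofResidues hX hρ⟩

end QuadDiff

namespace QuadDiff

/-! ### The pushforward in terms of residues -/

/-- The operator induced by `f_*` on residues: for a unicritical polynomial `f` with critical value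
`v`, the pushforward of `(z - a)⁻¹ (dz)²` has residues `1 / f' a` at `f a` and `- 1 / f' a` at `v`.
If `a` is the critical point, then `f' a = 0` and the convention `0⁻¹ = 0` gives the correct
value `0`. -/
noncomputable def residueMap (f : ℂ[X]) (v : ℂ) : (ℂ →₀ ℂ) →ₗ[ℂ] (ℂ →₀ ℂ) :=
  Finsupp.linearCombination ℂ fun a =>
    (f.derivative.eval a)⁻¹ • (Finsupp.single (f.eval a) 1 - Finsupp.single v 1)

theorem residueMap_single (f : ℂ[X]) (v a c : ℂ) :
    residueMap f v (Finsupp.single a c) = (c * (f.derivative.eval a)⁻¹) •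
      (Finsupp.single (f.eval a) 1 - Finsupp.single v 1) := by
  rw [residueMap, Finsupp.linearCombination_single, smul_smul]

theorem residueMap_eq_sum (f : ℂ[X]) (v : ℂ) (ρ : ℂ →₀ ℂ) :
    residueMap f v ρ = ∑ a ∈ ρ.support, ρ a • (f.derivative.eval a)⁻¹ •
      (Finsupp.single (f.eval a) 1 - Finsupp.single v 1) := by
  rw [residueMap, Finsupp.linearCombination_apply, Finsupp.sum]

theorem residueMap_apply (f : ℂ[X]) {v b : ℂ} (hb : b ≠ v) (ρ : ℂ →₀ ℂ) :
    residueMap f v ρ b = ∑ a ∈ ρ.support,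
      if f.eval a = b then ρ a * (f.derivative.eval a)⁻¹ else 0 := by
  classical
  rw [residueMap_eq_sum, Finsupp.finsetSum_apply]
  refine Finset.sum_congr rfl fun a _ => ?_
  simp [Finsupp.single_apply, hb.symm]

theorem residueMap_apply_of_unique (f : ℂ[X]) {v : ℂ} {ρ : ℂ →₀ ℂ} {a : ℂ} (ha : f.eval a ≠ v)
    (huniq : ∀ a', ρ a' ≠ 0 → f.eval a' = f.eval a → a' = a) :
    residueMap f v ρ (f.eval a) = ρ a * (f.derivative.eval a)⁻¹ := by
  rw [residueMap_apply f ha, Finset.sum_eq_single a]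
  · simp
  · intro a' ha' hne
    rw [if_neg]
    exact fun h => hne (huniq a' (by simpa using ha') h)
  · intro h
    simp [Finsupp.notMem_support_iff.1 h]

variable {D : ℕ} {α z₀ v : ℂ}

theorem pushforward_ofResidues (hD : 2 ≤ D) (hα : α ≠ 0) (ρ : ℂ →₀ ℂ) :
    pushforward (unicritical D α z₀ v) ((ofResidues ρ : ℂ → ℂ) : Coeff) =
      ((ofResidues (residueMap (unicritical D α z₀ v) v ρ) : ℂ → ℂ) : Coeff) := by
  induction ρ using Finsupp.induction_linear with
  | zero =>
    rw [map_zero, map_zero, map_zero]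
    exact map_zero (pushforward (unicritical D α z₀ v))
  | add ρ σ h₁ h₂ =>
    rw [map_add, map_add, map_add, Germ.coe_add, Germ.coe_add, map_add, h₁, h₂]
  | single a c =>
    have e : (ofResidues (Finsupp.single a c) : ℂ → ℂ) = c • fun z => (z - a)⁻¹ := by
      rw [ofResidues, Finsupp.linearCombination_single]
    have hc : ∀ g : ℂ → ℂ, ((c • g : ℂ → ℂ) : Coeff) = c • (g : Coeff) := fun _ => rfl
    have h : pushforward (unicritical D α z₀ v) ((fun z => (z - a)⁻¹ : ℂ → ℂ) : Coeff) =
        (pushforwardFun (unicritical D α z₀ v) (fun z => (z - a)⁻¹) : Coeff) := rfl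
    rw [e, hc, map_smul, residueMap_single, h, ← hc, Germ.coe_eq]
    have hfin : ∀ b : ℂ, ∀ᶠ y in cofinite, y ≠ b := fun b => by
      simp [eventually_cofinite]
    filter_upwards [hfin v, hfin ((unicritical D α z₀ v).eval a)] with y hy hya
    rw [Pi.smul_apply, pushforwardFun_inv_sub hD hα a hy hya]
    simp only [ofResidues, map_smul, map_sub, Finsupp.linearCombination_single, Pi.smul_apply,
      Pi.sub_apply, smul_eq_mul, one_mul]
    ring

theorem residueMap_mem_residues (hD : 2 ≤ D) (hα : α ≠ 0) {X : Set ℂ} (hv : v ∈ X)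
    (hX : ∀ z ∈ X, (unicritical D α z₀ v).eval z ∈ X) {ρ : ℂ →₀ ℂ} (hρ : ρ ∈ residues X) :
    residueMap (unicritical D α z₀ v) v ρ ∈ residues X := by
  have hD0 : (D : ℂ) ≠ 0 := by exact_mod_cast (by omega : D ≠ 0)
  rw [residues, Submodule.mem_inf, Submodule.mem_inf] at hρ ⊢
  obtain ⟨h1, h2, h3⟩ := hρ
  rw [LinearMap.mem_ker] at h2 h3
  refine ⟨?_, ?_, ?_⟩
  · rw [residueMap_eq_sum]
    refine Submodule.sum_mem _ fun a ha => Submodule.smul_mem _ _ (Submodule.smul_mem _ _ ?_)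
    exact Submodule.sub_mem _ (Finsupp.single_mem_supported ℂ _ (hX a (h1 ha)))
      (Finsupp.single_mem_supported ℂ _ hv)
  · rw [LinearMap.mem_ker, residueMap_eq_sum, map_sum]
    exact Finset.sum_eq_zero fun a _ => by simp
  · have h4 : Finsupp.linearCombination ℂ (fun a : ℂ => a - z₀) ρ = 0 := by
      have h5 := congrArg₂ (fun x y => x - z₀ * y) h3 h2
      simp only [Finsupp.linearCombination_apply, Finsupp.sum, Finset.mul_sum,
        ← Finset.sum_sub_distrib, mul_zero, sub_zero] at h5
      rw [Finsupp.linearCombination_apply, Finsupp.sum, ← h5]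
      refine Finset.sum_congr rfl fun a _ => ?_
      simp only [smul_eq_mul]
      ring
    rw [LinearMap.mem_ker, residueMap_eq_sum, map_sum]
    rw [Finsupp.linearCombination_apply, Finsupp.sum] at h4
    rw [← mul_zero ((D : ℂ)⁻¹), ← h4, Finset.mul_sum]
    refine Finset.sum_congr rfl fun a _ => ?_
    simp only [map_smul, map_sub, Finsupp.linearCombination_single, smul_eq_mul, one_mul,
      eval_unicritical, eval_derivative_unicritical, add_sub_cancel_right]
    by_cases ha : a - z₀ = 0
    · simp [ha, show D ≠ 0 by omega]
    · have hp : (a - z₀) ^ D = (a - z₀) ^ (D - 1) * (a - z₀) := by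
        rw [← pow_succ]; congr 1; omega
      have ha' : (a - z₀) ^ (D - 1) ≠ 0 := pow_ne_zero _ ha
      rw [hp]
      field_simp

/-! ### The dynamics on the set of poles -/

/-- Poles of an eigenvector outside a forward invariant set containing the critical value are
permuted by `f`, and going around a cycle determines a power of the eigenvalue. It suffices that
the eigenvector equation holds outside the invariant set. -/
theorem exists_cycle_of_residueMap_eq (f : ℂ[X]) {v ev : ℂ} {P : Set ℂ} (hv : v ∈ P)
    (hP : ∀ z ∈ P, f.eval z ∈ P) (hev : ev ≠ 0) {ρ : ℂ →₀ ℂ}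
    (h : ∀ b ∉ P, residueMap f v ρ b = ev * ρ b) {b : ℂ} (hb : b ∉ P) (hρb : ρ b ≠ 0) :
    ∃ m, 0 < m ∧ (fun z => f.eval z)^[m] b = b ∧
      ev ^ m * ∏ i ∈ Finset.range m, f.derivative.eval ((fun z => f.eval z)^[i] b) = 1 := by
  classical
  set F : ℂ → ℂ := fun z => f.eval z with hF
  set A : Finset ℂ := ρ.support.filter (· ∉ P) with hA
  have memA : ∀ a, a ∈ A ↔ ρ a ≠ 0 ∧ a ∉ P := fun a => by simp [hA]
  have hne : ∀ a, a ∉ P → a ≠ v := fun a ha h => ha (h ▸ hv)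
  have hsub : A ⊆ A.image F := by
    intro a ha
    rw [memA] at ha
    have h1 : residueMap f v ρ a ≠ 0 := by
      rw [h a ha.2]
      exact mul_ne_zero hev ha.1
    rw [residueMap_apply f (hne a ha.2)] at h1
    obtain ⟨x, hx, hx'⟩ := Finset.exists_ne_zero_of_sum_ne_zero h1
    have hxa : f.eval x = a := by
      by_contra hcon
      exact hx' (if_neg hcon)
    refine Finset.mem_image.2 ⟨x, (memA x).2 ⟨by simpa using hx, fun hxP => ha.2 ?_⟩, hxa⟩
    exact hxa ▸ hP x hxP
  have himg : A = A.image F := Finset.eq_of_subset_of_card_le hsub Finset.card_image_le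
  have hinj : Set.InjOn F A := Finset.card_image_iff.1 (by rw [← himg])
  have hmaps : Set.MapsTo F (A : Set ℂ) (A : Set ℂ) := by
    intro a ha
    rw [himg]
    exact Finset.mem_coe.2 (Finset.mem_image_of_mem F ha)
  have hrec : ∀ a ∈ A, f.derivative.eval a ≠ 0 ∧ ev * ρ (F a) * f.derivative.eval a = ρ a := by
    intro a ha
    have hfa := (memA _).1 (hmaps ha)
    have h1 := residueMap_apply_of_unique f (ρ := ρ) (hne _ hfa.2) (fun a' ha' haa' =>
      hinj ((memA a').2 ⟨ha', fun hP' => hfa.2 (by simp only [hF]; rw [← haa']; exact hP a' hP')⟩)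
        ha haa')
    rw [h _ hfa.2] at h1
    have h2 : f.derivative.eval a ≠ 0 := by
      intro h0
      rw [h0, inv_zero, mul_zero] at h1
      exact mul_ne_zero hev hfa.1 h1
    refine ⟨h2, ?_⟩
    simp only [hF]
    rw [h1, inv_mul_cancel_right₀ h2]
  have hbA : b ∈ A := (memA b).2 ⟨hρb, hb⟩
  have hper : ∃ m, 0 < m ∧ F^[m] b = b := by
    have hri : Function.Injective (hmaps.restrict F A A) := by
      intro x y hxy
      exact Subtype.ext (hinj x.2 y.2 (congrArg Subtype.val hxy))
    obtain ⟨m, hm, hm'⟩ := hri.mem_periodicPts ⟨b, hbA⟩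
    refine ⟨m, hm, ?_⟩
    have h1 := congrArg Subtype.val hm'
    rwa [hmaps.iterate_restrict] at h1
  obtain ⟨m, hm, hm'⟩ := hper
  refine ⟨m, hm, hm', ?_⟩
  have hiter : ∀ i, F^[i] b ∈ A := fun i => (hmaps.iterate i) hbA
  have hprod : ∀ k, ev ^ k * ρ (F^[k] b) *
      ∏ i ∈ Finset.range k, f.derivative.eval (F^[i] b) = ρ b := by
    intro k
    induction k with
    | zero => simp
    | succ k ih =>
      rw [Finset.prod_range_succ, Function.iterate_succ_apply', ← ih,
        ← (hrec _ (hiter k)).2]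
      ring
  have := hprod m
  rw [hm'] at this
  refine mul_right_cancel₀ hρb ?_
  linear_combination this

/-- The residues of an eigenvector with poles in the orbit of a periodic critical value `v` are
determined, backwards along the orbit, by the residue at the critical point, and their sum is
zero. -/
theorem exists_sum_eq_zero_of_residueMap_eq (f : ℂ[X]) {v ev : ℂ}
    (hv : v ∈ Function.periodicPts fun z => f.eval z)
    (hcrit : ∀ z, f.derivative.eval z = 0 → f.eval z = v) {ρ : ℂ →₀ ℂ} (hρ0 : ρ ≠ 0)
    (hsupp : ∀ a, ρ a ≠ 0 → ∃ n, (fun z => f.eval z)^[n] v = a)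
    (hsum : ∑ a ∈ ρ.support, ρ a = 0) (h : residueMap f v ρ = ev • ρ) :
    ∃ (n : ℕ) (a : ℕ → ℂ), 0 < n ∧
      (∀ j, j + 1 < n →
        a j ∈ (Function.periodicPts fun z => f.eval z) ∧ f.derivative.eval (a j) ≠ 0) ∧
      ∑ i ∈ Finset.range n, ev ^ i * ∏ j ∈ Finset.range i, f.derivative.eval (a j) = 0 := by
  classical
  set F : ℂ → ℂ := fun z => f.eval z with hF
  set p := Function.minimalPeriod F v with hp
  have hp0 : 0 < p := Function.minimalPeriod_pos_of_mem_periodicPts hv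
  set w : ℕ → ℂ := fun j => F^[j] v with hw
  have hwper : ∀ j, w j ∈ Function.periodicPts F := by
    intro j
    exact ((Function.bijOn_periodicPts F).mapsTo.iterate j) hv
  have hwinj : ∀ i < p, ∀ j < p, w i = w j → i = j := fun i hi j hj hij =>
    Function.iterate_injOn_Iio_minimalPeriod (Set.mem_Iio.2 hi) (Set.mem_Iio.2 hj) hij
  have hsupp' : ∀ a, ρ a ≠ 0 → ∃ j < p, w j = a := by
    intro a ha
    obtain ⟨n, hn⟩ := hsupp a ha
    refine ⟨n % p, Nat.mod_lt _ hp0, ?_⟩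
    rw [← hn]
    exact Function.iterate_mod_minimalPeriod_eq
  have hsuppper : ∀ a, ρ a ≠ 0 → a ∈ Function.periodicPts F := by
    intro a ha
    obtain ⟨j, -, rfl⟩ := hsupp' a ha
    exact hwper j
  have hwsucc : ∀ j, f.eval (w j) = w (j + 1) := fun j => by
    simp only [hw, Function.iterate_succ_apply']
    rfl
  have hwv : ∀ j, j + 1 < p → w (j + 1) ≠ v := by
    intro j hj hcon
    have := hwinj (j + 1) hj 0 hp0 hcon
    omega
  have hder : ∀ j, j + 1 < p → f.derivative.eval (w j) ≠ 0 := by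
    intro j hj h0
    exact hwv j hj (by rw [← hwsucc]; exact hcrit _ h0)
  have hrec : ∀ j, j + 1 < p → ρ (w j) = ev * f.derivative.eval (w j) * ρ (w (j + 1)) := by
    intro j hj
    have h1 := residueMap_apply_of_unique f (ρ := ρ) (a := w j) (v := v)
      (by rw [hwsucc]; exact hwv j hj)
      (fun a' ha' haa' => (Function.bijOn_periodicPts F).injOn (hsuppper a' ha') (hwper j) haa')
    rw [h, hwsucc, Finsupp.smul_apply, smul_eq_mul] at h1
    have h2 := hder j hj
    rw [mul_right_comm, h1, inv_mul_cancel_right₀ h2]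
  have hback : ∀ i, i < p → ρ (w (p - 1 - i)) =
      ρ (w (p - 1)) * (ev ^ i * ∏ j ∈ Finset.range i, f.derivative.eval (w (p - 2 - j))) := by
    intro i
    induction i with
    | zero => simp
    | succ i ih =>
      intro hi
      have h1 := ih (by omega)
      rw [hrec (p - 1 - (i + 1)) (by omega), show p - 1 - (i + 1) + 1 = p - 1 - i by omega, h1,
        Finset.prod_range_succ, show p - 2 - i = p - 1 - (i + 1) by omega]
      ring
  have htot : ∑ i ∈ Finset.range p, ρ (w (p - 1 - i)) = 0 := by
    rw [Finset.sum_range_reflect (fun j => ρ (w j)) p, ← hsum,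
      ← Finset.sum_image (s := Finset.range p) (g := w) (f := fun a => ρ a)
        (fun i hi j hj => hwinj i (by simpa using hi) j (by simpa using hj))]
    symm
    refine Finset.sum_subset (fun a ha => ?_) (fun a _ ha => by simpa using ha)
    obtain ⟨j, hj, rfl⟩ := hsupp' a (by simpa using ha)
    exact Finset.mem_image_of_mem w (Finset.mem_range.2 hj)
  have hlast : ρ (w (p - 1)) ≠ 0 := by
    intro h0
    refine hρ0 (Finsupp.ext fun a => ?_)
    by_contra ha
    obtain ⟨j, hj, rfl⟩ := hsupp' a ha
    have := hback (p - 1 - j) (by omega)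
    rw [h0, zero_mul, show p - 1 - (p - 1 - j) = j by omega] at this
    exact ha this
  refine ⟨p, fun j => w (p - 2 - j), hp0, fun j hj => ⟨hwper _, hder _ (by omega)⟩, ?_⟩
  rw [Finset.sum_congr rfl fun i hi => hback i (Finset.mem_range.1 hi), ← Finset.mul_sum] at htot
  exact (mul_eq_zero.1 htot).resolve_left hlast

end QuadDiff

/-! ### Integrality of periodic points -/

theorem IsAlgebraicUnit.inv {x : ℂ} (h : IsAlgebraicUnit x) : IsAlgebraicUnit x⁻¹ :=
  ⟨inv_ne_zero h.1, h.2.2, by rw [inv_inv]; exact h.2.1⟩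

theorem IsAlgebraicUnit.prod {ι : Type*} {s : Finset ι} {x : ι → ℂ}
    (h : ∀ i ∈ s, IsAlgebraicUnit (x i)) : IsAlgebraicUnit (∏ i ∈ s, x i) := by
  refine ⟨Finset.prod_ne_zero_iff.2 fun i hi => (h i hi).1,
    IsIntegral.prod _ fun i hi => (h i hi).2.1, ?_⟩
  rw [← Finset.prod_inv_distrib]
  exact IsIntegral.prod _ fun i hi => (h i hi).2.2

theorem IsAlgebraicUnit.pow {x : ℂ} (h : IsAlgebraicUnit x) (n : ℕ) : IsAlgebraicUnit (x ^ n) :=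
  ⟨pow_ne_zero _ h.1, h.2.1.pow n, by rw [← inv_pow]; exact h.2.2.pow n⟩

theorem IsAlgebraicUnit.of_pow {x : ℂ} {n : ℕ} (hn : 0 < n) (h : IsAlgebraicUnit (x ^ n)) :
    IsAlgebraicUnit x := by
  refine ⟨fun h0 => h.1 (by rw [h0, zero_pow hn.ne']), IsIntegral.of_pow hn h.2.1, ?_⟩
  refine IsIntegral.of_pow hn ?_
  rw [inv_pow]
  exact h.2.2

theorem isIntegral_of_pow_add_sum_eq_zero {x : ℂ} {n : ℕ} {c : ℕ → ℂ}
    (hc : ∀ i < n, IsIntegral ℤ (c i))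
    (h : x ^ n + ∑ i ∈ Finset.range n, c i * x ^ i = 0) : IsIntegral ℤ x := by
  let R := integralClosure ℤ ℂ
  have hlift : ∃ d : ℕ → R, ∀ i < n, (d i : ℂ) = c i := by
    choose d hd using fun i : Fin n => (⟨⟨c i, hc i i.2⟩, rfl⟩ : ∃ d : R, (d : ℂ) = c i)
    exact ⟨fun i => if hi : i < n then d ⟨i, hi⟩ else 0, fun i hi => by simp [hi, hd]⟩
  obtain ⟨d, hd⟩ := hlift
  have hx : IsIntegral R x := by
    refine ⟨X ^ n + ∑ i ∈ Finset.range n, C (d i) * X ^ i, monic_X_pow_add ?_, ?_⟩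
    · rw [← Fin.sum_univ_eq_sum_range (fun i => C (d i) * X ^ i) n]
      exact degree_sum_fin_lt _
    · rw [← h]
      simp only [eval₂_add, eval₂_X_pow, eval₂_finsetSum, eval₂_mul, eval₂_C]
      congr 1
      refine Finset.sum_congr rfl fun i hi => ?_
      rw [← hd i (Finset.mem_range.1 hi)]
      rfl
  exact isIntegral_trans (A := R) x hx

/-- Used with `t = X` over `ℤ`, where the iterates evaluated at `c` give the critical orbit of
`z ^ D + c`, and with `t = C c`, where they are the iterates of `z ^ D + c`. -/
theorem monic_iterate_pow_add {R : Type*} [CommRing R] [Nontrivial R] {D : ℕ} (hD : 2 ≤ D)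
    {t : R[X]} (ht : t.natDegree ≤ 1) (k : ℕ) :
    ((fun p : R[X] => p ^ D + t)^[k] X).Monic ∧
      ((fun p : R[X] => p ^ D + t)^[k] X).natDegree = D ^ k := by
  induction k with
  | zero => simp [monic_X]
  | succ k ih =>
    rw [Function.iterate_succ_apply']
    generalize (fun p : R[X] => p ^ D + t)^[k] X = q at ih
    have hdeg : (q ^ D).natDegree = D ^ (k + 1) := by
      rw [ih.1.natDegree_pow, ih.2, pow_succ, mul_comm]
    have hlt : t.natDegree < (q ^ D).natDegree := by
      rw [hdeg]
      calc t.natDegree ≤ 1 := ht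
        _ < D := hD
        _ ≤ D ^ (k + 1) := Nat.le_self_pow (by omega) D
    refine ⟨(ih.1.pow D).add_of_left (degree_lt_degree hlt), ?_⟩
    rw [natDegree_add_eq_left_of_natDegree_lt hlt, hdeg]

theorem aeval_iterate_pow_add {R : Type*} [CommRing R] [Algebra R ℂ] {D : ℕ} (t : R[X]) (x : ℂ)
    (k : ℕ) : aeval x ((fun p : R[X] => p ^ D + t)^[k] X) =
      (fun z : ℂ => z ^ D + aeval x t)^[k] x := by
  induction k with
  | zero => simp
  | succ k ih => rw [Function.iterate_succ_apply', Function.iterate_succ_apply', ← ih]; simp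

section PowAdd

variable {D : ℕ} {c : ℂ}

theorem isIntegral_of_zero_mem_periodicPts (hD : 2 ≤ D)
    (hc : 0 ∈ Function.periodicPts fun z : ℂ => z ^ D + c) : IsIntegral ℤ c := by
  obtain ⟨p, hp, h⟩ := hc
  obtain ⟨k, rfl⟩ : ∃ k, p = k + 1 := ⟨p - 1, by omega⟩
  refine ⟨(fun p : ℤ[X] => p ^ D + X)^[k] X,
    (monic_iterate_pow_add hD natDegree_X_le k).1, ?_⟩
  have h2 := aeval_iterate_pow_add (R := ℤ) (D := D) X c k
  rw [aeval_X] at h2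
  rw [← aeval_def, h2]
  have h1 : (fun z : ℂ => z ^ D + c)^[k + 1] 0 = 0 := h
  rw [Function.iterate_succ_apply] at h1
  simpa [show D ≠ 0 by omega] using h1

theorem isIntegral_of_mem_periodicPts (hD : 2 ≤ D) (hc : IsIntegral ℤ c) {x : ℂ}
    (hx : x ∈ Function.periodicPts fun z : ℂ => z ^ D + c) : IsIntegral ℤ x := by
  obtain ⟨m, hm, h⟩ := hx
  let R := integralClosure ℤ ℂ
  let c' : R := ⟨c, hc⟩
  obtain ⟨h1, h2⟩ := monic_iterate_pow_add (R := R) hD (t := C c') (by simp) m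
  have h3 := aeval_iterate_pow_add (R := R) (D := D) (C c') x m
  have hc' : aeval x (C c') = c := by rw [aeval_C]; rfl
  rw [hc', show (fun z : ℂ => z ^ D + c)^[m] x = x from h] at h3
  have hlt : (X : R[X]).natDegree < ((fun p : R[X] => p ^ D + C c')^[m] X).natDegree := by
    rw [h2, natDegree_X]
    calc 1 < D := hD
      _ ≤ D ^ m := Nat.le_self_pow (by omega) D
  have hxR : IsIntegral R x := by
    refine ⟨(fun p : R[X] => p ^ D + C c')^[m] X - X, ?_, ?_⟩
    · exact h1.sub_of_left (degree_lt_degree hlt)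
    · rw [← aeval_def, map_sub, h3, aeval_X, sub_self]
  exact isIntegral_trans (A := R) x hxR

theorem pow_dvd_iterate_sub_iterate {R : Type*} [CommRing R] (D : ℕ) (c x : R) (k : ℕ) :
    x ^ D ∣ (fun z => z ^ D + c)^[k + 1] x - (fun z => z ^ D + c)^[k + 1] (0 : R) := by
  induction k with
  | zero => rcases D with _ | D <;> simp
  | succ k ih =>
    rw [Function.iterate_succ_apply', Function.iterate_succ_apply' _ _ (0 : R)]
    generalize (fun z => z ^ D + c)^[k + 1] x = a at ih
    generalize (fun z => z ^ D + c)^[k + 1] (0 : R) = b at ih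
    rw [add_sub_add_right_eq_sub]
    exact ih.trans (sub_dvd_pow_sub_pow a b D)

/-- If `0` is periodic, then a nonzero periodic point `x` is a unit: at a common period `n`, one has
`x = fⁿ(x) - fⁿ(0)`, which is divisible by `x ^ D`. -/
theorem isAlgebraicUnit_of_mem_periodicPts (hD : 2 ≤ D)
    (hc : 0 ∈ Function.periodicPts fun z : ℂ => z ^ D + c) {x : ℂ}
    (hx : x ∈ Function.periodicPts fun z : ℂ => z ^ D + c) (hx0 : x ≠ 0) : IsAlgebraicUnit x := by
  have hci := isIntegral_of_zero_mem_periodicPts hD hc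
  have hxi := isIntegral_of_mem_periodicPts hD hci hx
  refine ⟨hx0, hxi, ?_⟩
  obtain ⟨p, hp, hp'⟩ := hc
  obtain ⟨m, hm, hm'⟩ := hx
  obtain ⟨k, hk⟩ : ∃ k, p * m = k + 1 := ⟨p * m - 1, by have := Nat.mul_pos hp hm; omega⟩
  have h0 : (fun z : ℂ => z ^ D + c)^[k + 1] 0 = 0 := hk ▸ hp'.mul_const m
  have h1 : (fun z : ℂ => z ^ D + c)^[k + 1] x = x := hk ▸ hm'.const_mul p
  let R := integralClosure ℤ ℂ
  let c' : R := ⟨c, hci⟩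
  let x' : R := ⟨x, hxi⟩
  have hsemi : Function.Semiconj (Subtype.val : R → ℂ) (fun z : R => z ^ D + c')
      (fun z : ℂ => z ^ D + c) := fun z => rfl
  obtain ⟨h, hh⟩ := pow_dvd_iterate_sub_iterate D c' x' k
  have h2 := congrArg (Subtype.val : R → ℂ) hh
  have e1 : ((((fun z => z ^ D + c')^[k + 1] x' - (fun z => z ^ D + c')^[k + 1] 0 : R)) : ℂ) =
      x - 0 := by
    rw [← h1, ← h0]
    exact congrArg₂ (· - ·) (hsemi.iterate_right (k + 1) x') (hsemi.iterate_right (k + 1) 0)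
  rw [e1, sub_zero] at h2
  have h3 : x = x ^ D * (h : ℂ) := h2
  have hinv : x⁻¹ = x ^ (D - 2) * (h : ℂ) := by
    have e : x ^ D = x ^ (D - 2) * x * x := by
      rw [mul_assoc, ← sq, ← pow_add]; congr 1; omega
    rw [e] at h3
    refine inv_eq_of_mul_eq_one_right (mul_right_cancel₀ hx0 ?_)
    linear_combination -h3
  rw [hinv]
  exact (hxi.pow _).mul h.2

/-- Escape radius: if `‖x‖ ^ (D - 1) > 2` and `‖x‖ ≥ ‖c‖`, then the orbit of `x` has increasing
norms. -/
theorem notMem_periodicPts_of_lt (hD : 2 ≤ D) {x : ℂ} (hx : 2 < ‖x‖ ^ (D - 1)) (hxc : ‖c‖ ≤ ‖x‖) :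
    x ∉ Function.periodicPts fun z : ℂ => z ^ D + c := by
  have step : ∀ y : ℂ, 2 < ‖y‖ ^ (D - 1) → ‖c‖ ≤ ‖y‖ → ‖y‖ < ‖y ^ D + c‖ := by
    intro y hy hyc
    have hy0 : 0 < ‖y‖ := by
      rw [norm_pos_iff]
      rintro rfl
      rw [norm_zero, zero_pow (by omega)] at hy
      norm_num at hy
    have h1 : ‖y ^ D‖ - ‖c‖ ≤ ‖y ^ D + c‖ := by
      have := norm_sub_norm_le (y ^ D) (-c)
      rwa [norm_neg, sub_neg_eq_add] at this
    have h2 : ‖y ^ D‖ = ‖y‖ ^ (D - 1) * ‖y‖ := by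
      rw [norm_pow, ← pow_succ]; congr 1; omega
    rw [h2] at h1
    nlinarith
  have hmono : ∀ k, ‖x‖ ≤ ‖(fun z : ℂ => z ^ D + c)^[k] x‖ ∧
      ‖x‖ < ‖(fun z : ℂ => z ^ D + c)^[k + 1] x‖ := by
    intro k
    induction k with
    | zero => exact ⟨le_rfl, step x hx hxc⟩
    | succ k ih =>
      refine ⟨ih.2.le, ih.2.trans ?_⟩
      rw [Function.iterate_succ_apply' _ (k + 1)]
      refine step _ (hx.trans_le ?_) (hxc.trans ih.2.le)
      exact pow_le_pow_left₀ (norm_nonneg _) ih.2.le _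
  rintro ⟨m, hm, h⟩
  obtain ⟨k, rfl⟩ : ∃ k, m = k + 1 := ⟨m - 1, by omega⟩
  have h1 : (fun z : ℂ => z ^ D + c)^[k + 1] x = x := h
  have h2 := (hmono k).2
  rw [h1] at h2
  exact lt_irrefl _ h2

theorem norm_pow_le_of_mem_periodicPts (hD : 2 ≤ D)
    (hc : 0 ∈ Function.periodicPts fun z : ℂ => z ^ D + c) {x : ℂ}
    (hx : x ∈ Function.periodicPts fun z : ℂ => z ^ D + c) : ‖x‖ ^ (D - 1) ≤ 2 := by
  have hcper : c ∈ Function.periodicPts fun z : ℂ => z ^ D + c := by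
    have := (Function.bijOn_periodicPts fun z : ℂ => z ^ D + c).mapsTo hc
    simpa [show D ≠ 0 by omega] using this
  have hc2 : ‖c‖ ^ (D - 1) ≤ 2 := by
    by_contra! h
    exact notMem_periodicPts_of_lt hD h le_rfl hcper
  by_contra! h
  refine notMem_periodicPts_of_lt hD h ?_ hx
  exact (lt_of_pow_lt_pow_left₀ _ (norm_nonneg _) (hc2.trans_lt h)).le

end PowAdd

namespace QuadDiff

variable {D : ℕ} {α z₀ v : ℂ}

/-- Conjugating `f` to the normal form `z ^ D + c`, the quantity `f'(a) / D` at a periodic point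
becomes the `(D - 1)`-st power of a periodic point. -/
theorem derivative_eq_mul_unit_of_mem_periodicPts (hD : 2 ≤ D) (hα : α ≠ 0)
    (hz₀ : z₀ ∈ Function.periodicPts fun z => (unicritical D α z₀ v).eval z) {a : ℂ}
    (ha : a ∈ Function.periodicPts fun z => (unicritical D α z₀ v).eval z)
    (hda : (unicritical D α z₀ v).derivative.eval a ≠ 0) :
    ∃ s : ℂ, (unicritical D α z₀ v).derivative.eval a = D * s ∧ IsAlgebraicUnit s ∧ ‖s‖ ≤ 2 := by
  obtain ⟨β, hβ⟩ := IsAlgClosed.exists_pow_nat_eq α⁻¹ (show 0 < D - 1 by omega)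
  have hβ0 : β ≠ 0 := by
    rintro rfl
    rw [zero_pow (by omega), eq_comm, inv_eq_zero] at hβ
    exact hα hβ
  have hβD : α * β ^ D = β := by
    have : β ^ D = β ^ (D - 1) * β := by rw [← pow_succ]; congr 1; omega
    rw [this, hβ, ← mul_assoc, mul_inv_cancel₀ hα, one_mul]
  set c := (v - z₀) / β with hc
  have hsemi : Function.Semiconj (fun z => (z - z₀) / β)
      (fun z => (unicritical D α z₀ v).eval z) (fun z => z ^ D + c) := by
    intro z
    have hβp : β ^ D ≠ 0 := pow_ne_zero _ hβ0
    simp only [eval_unicritical, hc, div_pow]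
    rw [← sub_eq_zero]
    field_simp
    linear_combination (z - z₀) ^ D * hβD
  have hmaps := hsemi.mapsTo_periodicPts
  have h0 : 0 ∈ Function.periodicPts fun z : ℂ => z ^ D + c := by
    have := hmaps hz₀
    simpa using this
  have hx := hmaps ha
  have ha0 : a - z₀ ≠ 0 := by
    intro h
    apply hda
    rw [eval_derivative_unicritical, h, zero_pow (by omega), mul_zero]
  have hx0 : (a - z₀) / β ≠ 0 := div_ne_zero ha0 hβ0
  refine ⟨((a - z₀) / β) ^ (D - 1), ?_,
    (isAlgebraicUnit_of_mem_periodicPts hD h0 hx hx0).pow _, ?_⟩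
  · rw [eval_derivative_unicritical, div_pow, hβ, div_inv_eq_mul]
    ring
  · rw [norm_pow]
    exact norm_pow_le_of_mem_periodicPts hD h0 hx

/-! ### Arithmetic of the eigenvalues -/

theorem isAlgebraicUnit_of_pow_mul_prod_eq_one {x : ℂ} {m : ℕ} (hm : 0 < m) {s : ℕ → ℂ}
    (hs : ∀ i < m, IsAlgebraicUnit (s i)) (h : x ^ m * ∏ i ∈ Finset.range m, s i = 1) :
    IsAlgebraicUnit x := by
  refine IsAlgebraicUnit.of_pow hm ?_
  rw [eq_inv_of_mul_eq_one_left h]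
  exact (IsAlgebraicUnit.prod fun i hi => hs i (Finset.mem_range.1 hi)).inv

theorem half_le_norm_of_pow_mul_prod_eq_one {x : ℂ} {m : ℕ} (hm : 0 < m) {s : ℕ → ℂ}
    (hs : ∀ i < m, ‖s i‖ ≤ 2) (h : x ^ m * ∏ i ∈ Finset.range m, s i = 1) : 1 / 2 ≤ ‖x‖ := by
  have h1 : ∏ i ∈ Finset.range m, ‖s i‖ ≤ 2 ^ m := by
    calc ∏ i ∈ Finset.range m, ‖s i‖ ≤ ∏ _i ∈ Finset.range m, (2 : ℝ) :=
          Finset.prod_le_prod (fun i _ => norm_nonneg _) fun i hi => hs i (Finset.mem_range.1 hi)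
      _ = 2 ^ m := by simp
  have h2 := congrArg norm h
  rw [norm_mul, norm_pow, norm_prod, norm_one] at h2
  by_contra! hlt
  have h3 : ‖x‖ ^ m < (1 / 2) ^ m := pow_lt_pow_left₀ hlt (norm_nonneg _) hm.ne'
  have h4 : ‖x‖ ^ m * ∏ i ∈ Finset.range m, ‖s i‖ ≤ ‖x‖ ^ m * 2 ^ m :=
    mul_le_mul_of_nonneg_left h1 (by positivity)
  have h5 : ‖x‖ ^ m * 2 ^ m < (1 / 2) ^ m * 2 ^ m := mul_lt_mul_of_pos_right h3 (by positivity)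
  have h6 : (1 / 2 : ℝ) ^ m * 2 ^ m = 1 := by rw [← mul_pow]; norm_num
  linarith

theorem isAlgebraicUnit_of_sum_pow_mul_prod_eq_zero {x : ℂ} {n : ℕ} (hn : 0 < n) {s : ℕ → ℂ}
    (hs : ∀ j, j + 1 < n → IsAlgebraicUnit (s j))
    (h : ∑ i ∈ Finset.range n, x ^ i * ∏ j ∈ Finset.range i, s j = 0) : IsAlgebraicUnit x := by
  obtain ⟨m, rfl⟩ : ∃ m, n = m + 1 := ⟨n - 1, by omega⟩
  set σ : ℕ → ℂ := fun i => ∏ j ∈ Finset.range i, s j with hσ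
  have hσu : ∀ i ≤ m, IsAlgebraicUnit (σ i) := fun i hi =>
    IsAlgebraicUnit.prod fun j hj => hs j (by have := Finset.mem_range.1 hj; omega)
  have hσ0 : σ 0 = 1 := by simp [hσ]
  change ∑ i ∈ Finset.range (m + 1), x ^ i * σ i = 0 at h
  have hx0 : x ≠ 0 := by
    rintro rfl
    rw [Finset.sum_range_succ'] at h
    simp [hσ0] at h
  refine ⟨hx0, ?_, ?_⟩
  · refine isIntegral_of_pow_add_sum_eq_zero (n := m) (c := fun i => σ i * (σ m)⁻¹)
      (fun i hi => (hσu i hi.le).2.1.mul (hσu m le_rfl).2.2) ?_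
    rw [Finset.sum_range_succ] at h
    have hm0 := (hσu m le_rfl).1
    have e : ∑ i ∈ Finset.range m, σ i * (σ m)⁻¹ * x ^ i =
        (∑ i ∈ Finset.range m, x ^ i * σ i) * (σ m)⁻¹ := by
      rw [Finset.sum_mul]
      exact Finset.sum_congr rfl fun i _ => by ring
    rw [e, eq_neg_of_add_eq_zero_left h, neg_mul, mul_inv_cancel_right₀ hm0, add_neg_cancel]
  · refine isIntegral_of_pow_add_sum_eq_zero (n := m) (c := fun i => σ (m - i))
      (fun i hi => (hσu (m - i) (by omega)).2.1) ?_
    rw [← Finset.sum_range_reflect] at h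
    rw [Finset.sum_range_succ] at h
    have hxm : x ^ m ≠ 0 := pow_ne_zero _ hx0
    refine mul_left_cancel₀ hxm ?_
    rw [mul_zero, mul_add, Finset.mul_sum, ← mul_pow, mul_inv_cancel₀ hx0, one_pow]
    simp only [Nat.add_sub_cancel, Nat.sub_self, pow_zero, hσ0, mul_one] at h
    rw [add_comm, ← h]
    congr 1
    refine Finset.sum_congr rfl fun i hi => ?_
    have him := Finset.mem_range.1 hi
    have e : x ^ m = x ^ (m - i) * x ^ i := by rw [← pow_add]; congr 1; omega
    rw [e, inv_pow]
    field_simp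

/-- If `‖x‖ ≤ 1 / 4`, the terms with `i ≥ 1` are bounded by `2⁻ⁱ` and cannot cancel the term `1` with
`i = 0`. -/
theorem quarter_lt_norm_of_sum_pow_mul_prod_eq_zero {x : ℂ} {n : ℕ} (hn : 0 < n) {s : ℕ → ℂ}
    (hs : ∀ j, j + 1 < n → ‖s j‖ ≤ 2)
    (h : ∑ i ∈ Finset.range n, x ^ i * ∏ j ∈ Finset.range i, s j = 0) : 1 / 4 < ‖x‖ := by
  obtain ⟨m, rfl⟩ : ∃ m, n = m + 1 := ⟨n - 1, by omega⟩
  by_contra! hx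
  have hterm : ∀ i ∈ Finset.range m, ‖x ^ (i + 1) * ∏ j ∈ Finset.range (i + 1), s j‖ ≤
      1 / 2 * (1 / 2) ^ i := by
    intro i hi
    rw [Finset.mem_range] at hi
    rw [norm_mul, norm_pow, norm_prod]
    have h1 : ∏ j ∈ Finset.range (i + 1), ‖s j‖ ≤ 2 ^ (i + 1) := by
      calc ∏ j ∈ Finset.range (i + 1), ‖s j‖ ≤ ∏ _j ∈ Finset.range (i + 1), (2 : ℝ) :=
            Finset.prod_le_prod (fun _ _ => norm_nonneg _) fun j hj =>
              hs j (by have := Finset.mem_range.1 hj; omega)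
        _ = 2 ^ (i + 1) := by simp
    calc ‖x‖ ^ (i + 1) * ∏ j ∈ Finset.range (i + 1), ‖s j‖
        ≤ (1 / 4) ^ (i + 1) * 2 ^ (i + 1) := by gcongr
      _ = 1 / 2 * (1 / 2) ^ i := by rw [← mul_pow, pow_succ]; norm_num; ring
  rw [Finset.sum_range_succ', pow_zero, Finset.prod_range_zero, mul_one] at h
  have h1 : (1 : ℝ) ≤ ∑ i ∈ Finset.range m, 1 / 2 * (1 / 2 : ℝ) ^ i := by
    calc (1 : ℝ) = ‖∑ i ∈ Finset.range m, x ^ (i + 1) * ∏ j ∈ Finset.range (i + 1), s j‖ := by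
          rw [eq_neg_of_add_eq_zero_left h, norm_neg, norm_one]
      _ ≤ _ := norm_sum_le_of_le _ hterm
  have e : ∀ y : ℝ, 1 / 2 * ((y - 1) / (1 / 2 - 1)) = 1 - y := fun y => by
    norm_num
    ring
  rw [← Finset.mul_sum, geom_sum_eq (by norm_num), e] at h1
  have h2 : (0 : ℝ) < (1 / 2) ^ m := by positivity
  linarith

end QuadDiff

open MeasureTheory
open scoped ENNReal

namespace QuadDiff

/-! ### Integrability of quadratic differentials with simple poles -/

theorem measurable_ofResidues (ρ : ℂ →₀ ℂ) : Measurable (ofResidues ρ) := by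
  have : ofResidues ρ = fun z => ∑ a ∈ ρ.support, ρ a * (z - a)⁻¹ :=
    funext (ofResidues_apply ρ)
  rw [this]
  fun_prop

theorem integrableOn_inv_sub (a : ℂ) (r : ℝ) :
    IntegrableOn (fun z : ℂ => (z - a)⁻¹) (Metric.closedBall 0 r) := by
  have h1 : IntegrableOn (fun z : ℂ => z⁻¹) (Metric.ball 0 (r + ‖a‖ + 1)) := by
    refine integrableOn_ball_of_norm_le_rpow (C := 1) (α := 1) ?_ ?_ ?_ ?_
    · rw [Complex.finrank_real_complex]
      norm_num
    · rw [Complex.finrank_real_complex]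
      norm_num
    · refine Eventually.of_forall fun z => ?_
      rw [norm_inv, Real.rpow_neg_one, one_mul]
    · exact measurable_inv.aestronglyMeasurable
  have h2 := ((measurePreserving_sub_right (volume : Measure ℂ) a).integrableOn_comp_preimage
    (MeasurableEquiv.subRight a).measurableEmbedding).2 h1
  refine h2.mono_set fun z hz => ?_
  rw [mem_closedBall_zero_iff] at hz
  rw [Set.mem_preimage, mem_ball_zero_iff]
  have := norm_sub_le z a
  linarith

theorem integrable_ofResidues {ρ : ℂ →₀ ℂ} (hρ : ρ ∈ residues Set.univ) :
    Integrable (ofResidues ρ) := by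
  have hρ' : HasSimplePolesIn Set.univ (ofResidues ρ) :=
    hasSimplePolesIn_ofResidues (Set.mem_univ _) (by simpa using hρ)
  obtain ⟨l, hl⟩ := (neg_one_le_order_iff (hρ' OnePoint.infty).1).1 (hρ' OnePoint.infty).2.1
  have hdecay : ∀ᶠ z in Bornology.cobounded ℂ, ‖z‖ ^ 3 * ‖ofResidues ρ z‖ < ‖l‖ + 1 := by
    have h1 := (hl.comp tendsto_inv₀_cobounded').norm.eventually_lt_const (lt_add_one ‖l‖)
    filter_upwards [h1, Bornology.le_cofinite ℂ (Set.finite_singleton (0 : ℂ)).compl_mem_cofinite]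
      with z hz hz0
    have hz0' : z ≠ 0 := hz0
    have e : (z⁻¹ - 0) * coeffAtInfty (ofResidues ρ) z⁻¹ = z ^ 3 * ofResidues ρ z := by
      simp only [coeffAtInfty, inv_inv, sub_zero]
      field_simp
    simpa only [Function.comp, e, norm_mul, norm_pow] using hz
  obtain ⟨r, hr⟩ := (Metric.isBounded_iff_subset_closedBall (0 : ℂ)).1
    (Bornology.isBounded_def.2 (show {z | ‖z‖ ^ 3 * ‖ofResidues ρ z‖ < ‖l‖ + 1}ᶜᶜ ∈ _ by
      rwa [compl_compl]))
  set R := max r 1 with hR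
  rw [← integrableOn_univ, ← Set.union_compl_self (Metric.closedBall (0 : ℂ) R)]
  refine IntegrableOn.union ?_ ?_
  · have : ofResidues ρ = fun z => ∑ a ∈ ρ.support, ρ a * (z - a)⁻¹ :=
      funext (ofResidues_apply ρ)
    rw [this]
    exact integrable_finsetSum _ fun a _ => (integrableOn_inv_sub a R).const_mul (ρ a)
  · have h3 : Integrable (fun z : ℂ => 8 * (‖l‖ + 1) * (1 + ‖z‖) ^ (-3 : ℝ)) :=
      (integrable_one_add_norm (by rw [Complex.finrank_real_complex]; norm_num)).const_mul _
    refine h3.integrableOn.mono' (measurable_ofResidues ρ).aestronglyMeasurable ?_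
    refine (ae_restrict_iff' Metric.isClosed_closedBall.measurableSet.compl).2
      (Eventually.of_forall fun z hz => ?_)
    have hzR : R < ‖z‖ := by simpa using hz
    have hz1 : 1 < ‖z‖ := (le_max_right r 1).trans_lt hzR
    have hzd : ‖z‖ ^ 3 * ‖ofResidues ρ z‖ < ‖l‖ + 1 := by
      by_contra hcon
      have := hr hcon
      rw [mem_closedBall_zero_iff] at this
      exact absurd ((le_max_left r 1).trans_lt hzR) (not_lt.2 this)
    rw [Real.rpow_neg (by positivity), ← div_eq_mul_inv, le_div_iff₀ (by positivity)]
    rw [show (3 : ℝ) = ((3 : ℕ) : ℝ) by norm_num, Real.rpow_natCast]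
    have h4 : (1 + ‖z‖) ^ 3 ≤ (2 * ‖z‖) ^ 3 := by
      refine pow_le_pow_left₀ (by positivity) ?_ 3
      linarith
    calc ‖ofResidues ρ z‖ * (1 + ‖z‖) ^ 3 ≤ ‖ofResidues ρ z‖ * (2 * ‖z‖) ^ 3 := by gcongr
      _ = 8 * (‖z‖ ^ 3 * ‖ofResidues ρ z‖) := by ring
      _ ≤ 8 * (‖l‖ + 1) := by linarith

/-! ### The pushforward does not increase the area -/

theorem abs_det_restrictScalars_toSpanSingleton (c : ℂ) :
    |((ContinuousLinearMap.toSpanSingleton ℂ c).restrictScalars ℝ).det| = ‖c‖ ^ 2 := by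
  have : ((ContinuousLinearMap.toSpanSingleton ℂ c).restrictScalars ℝ).det = ‖c‖ ^ 2 := by
    simp [ContinuousLinearMap.det, LinearMap.det_restrictScalars, Algebra.norm_complex_eq,
      Complex.normSq_eq_norm_sq]
  rw [this, abs_of_nonneg (by positivity)]

section Branches

variable (D : ℕ) (α z₀ v : ℂ)

/-- The plane minus a ray issued from the critical value `v`, on which the inverse branches of
`α (z - z₀) ^ D + v` are defined. -/
def slit : Set ℂ := {y | (y - v) / α ∈ Complex.slitPlane}

/-- The `k`-th inverse branch of `α (z - z₀) ^ D + v` on the slit plane. -/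
noncomputable def branch (k : ℕ) (y : ℂ) : ℂ :=
  z₀ + Complex.exp (2 * Real.pi * Complex.I / D) ^ k * ((y - v) / α) ^ ((D : ℂ)⁻¹)

variable {D α z₀ v}

theorem isOpen_slit : IsOpen (slit α v) := by
  have : Continuous fun y : ℂ => (y - v) / α := by fun_prop
  exact Complex.isOpen_slitPlane.preimage this

theorem sum_roots_eq_sum_branch {M : Type*} [AddCommMonoid M] (hD : D ≠ 0) (hα : α ≠ 0) {y : ℂ}
    (hy : y ∈ slit α v) (g : ℂ → M) :
    ∑ x ∈ (unicritical D α z₀ v - C y).roots.toFinset, g x =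
      ∑ k ∈ Finset.range D, g (branch D α z₀ v k y) := by
  have hs : ((y - v) / α) ^ ((D : ℂ)⁻¹) ≠ 0 := by
    rw [Complex.cpow_ne_zero_iff_of_exponent_ne_zero (inv_ne_zero (by exact_mod_cast hD))]
    exact Complex.slitPlane_ne_zero hy
  have e : y = α * (((y - v) / α) ^ ((D : ℂ)⁻¹)) ^ D + v := by
    rw [Complex.cpow_nat_inv_pow _ hD]
    field_simp
    ring
  conv_lhs => rw [e]
  exact sum_roots_unicritical hD hα (Complex.isPrimitiveRoot_exp D hD) hs g

theorem eval_branch (hD : D ≠ 0) (hα : α ≠ 0) (k : ℕ) (y : ℂ) :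
    (unicritical D α z₀ v).eval (branch D α z₀ v k y) = y := by
  rw [eval_unicritical, branch, add_sub_cancel_left, mul_pow, Complex.cpow_nat_inv_pow _ hD,
    ← pow_mul, mul_comm k, pow_mul, (Complex.isPrimitiveRoot_exp D hD).pow_eq_one]
  field_simp
  simp

theorem hasDerivAt_branch (hD : D ≠ 0) (hα : α ≠ 0) (k : ℕ) {y : ℂ} (hy : y ∈ slit α v) :
    HasDerivAt (branch D α z₀ v k)
      ((unicritical D α z₀ v).derivative.eval (branch D α z₀ v k y))⁻¹ y := by
  have h1 : DifferentiableAt ℂ (branch D α z₀ v k) y := by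
    refine (differentiableAt_const _).add ((differentiableAt_const _).mul ?_)
    refine DifferentiableAt.cpow (by fun_prop) (by fun_prop) hy
  have h2 : HasDerivAt (fun x => (unicritical D α z₀ v).eval (branch D α z₀ v k x))
      ((unicritical D α z₀ v).derivative.eval (branch D α z₀ v k y) *
        deriv (branch D α z₀ v k) y) y :=
    ((unicritical D α z₀ v).hasDerivAt (branch D α z₀ v k y)).comp y h1.hasDerivAt
  have h3 : (fun x => (unicritical D α z₀ v).eval (branch D α z₀ v k x)) = id :=
    funext fun x => eval_branch hD hα k x
  rw [h3] at h2
  rw [← eq_inv_of_mul_eq_one_right (h2.unique (hasDerivAt_id y))]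
  exact h1.hasDerivAt

theorem disjoint_branch_image (hD : D ≠ 0) (hα : α ≠ 0) {i j : ℕ} (hi : i < D) (hj : j < D)
    (hij : i ≠ j) : Disjoint (branch D α z₀ v i '' slit α v) (branch D α z₀ v j '' slit α v) := by
  rw [Set.disjoint_left]
  rintro _ ⟨y, hy, rfl⟩ ⟨y', hy', h⟩
  have hyy : y' = y := by
    rw [← eval_branch (z₀ := z₀) (v := v) hD hα j y', h, eval_branch hD hα]
  subst hyy
  have hs : ((y' - v) / α) ^ ((D : ℂ)⁻¹) ≠ 0 := by
    rw [Complex.cpow_ne_zero_iff_of_exponent_ne_zero (inv_ne_zero (by exact_mod_cast hD))]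
    exact Complex.slitPlane_ne_zero hy
  simp only [branch, add_right_inj, mul_left_inj' hs] at h
  exact hij ((Complex.isPrimitiveRoot_exp D hD).pow_inj hi hj h.symm)

/-- Change of variables along the inverse branches. -/
theorem lintegral_sum_branch_le (hD : D ≠ 0) (hα : α ≠ 0) {g : ℂ → ℝ≥0∞} (hg : Measurable g) :
    AEMeasurable (fun y => ∑ x ∈ (unicritical D α z₀ v - C y).roots.toFinset,
        ENNReal.ofReal (‖((unicritical D α z₀ v).derivative.eval x)⁻¹‖ ^ 2) * g x)
        (volume.restrict (slit α v)) ∧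
      ∫⁻ y in slit α v, ∑ x ∈ (unicritical D α z₀ v - C y).roots.toFinset,
        ENNReal.ofReal (‖((unicritical D α z₀ v).derivative.eval x)⁻¹‖ ^ 2) * g x ≤
      ∫⁻ x, g x := by
  set f := unicritical D α z₀ v with hf
  have hU : MeasurableSet (slit α v) := isOpen_slit.measurableSet
  have hmb : ∀ k, Measurable (branch D α z₀ v k) := fun k => by
    unfold branch
    fun_prop
  have hmf : Measurable fun x => f.derivative.eval x := f.derivative.continuous.measurable
  have hm : ∀ k, Measurable fun y =>
      ENNReal.ofReal (‖(f.derivative.eval (branch D α z₀ v k y))⁻¹‖ ^ 2) *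
        g (branch D α z₀ v k y) := by
    intro k
    have h1 := hmf.comp (hmb k)
    exact ((h1.inv.norm.pow_const 2).ennreal_ofReal).mul (hg.comp (hmb k))
  have hinj : ∀ k, Set.InjOn (branch D α z₀ v k) (slit α v) := fun k y _ y' _ h => by
    rw [← eval_branch (z₀ := z₀) (v := v) hD hα k y, h, eval_branch hD hα]
  have hder : ∀ k, ∀ y ∈ slit α v, HasFDerivWithinAt (branch D α z₀ v k)
      ((ContinuousLinearMap.toSpanSingleton ℂ
        (f.derivative.eval (branch D α z₀ v k y))⁻¹).restrictScalars ℝ) (slit α v) y :=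
    fun k y hy => ((hasDerivAt_branch hD hα k hy).hasFDerivAt.restrictScalars ℝ).hasFDerivWithinAt
  have heq : ∀ y ∈ slit α v, ∑ x ∈ (f - C y).roots.toFinset,
      ENNReal.ofReal (‖(f.derivative.eval x)⁻¹‖ ^ 2) * g x = ∑ k ∈ Finset.range D,
        ENNReal.ofReal (‖(f.derivative.eval (branch D α z₀ v k y))⁻¹‖ ^ 2) *
          g (branch D α z₀ v k y) := fun y hy =>
    sum_roots_eq_sum_branch hD hα hy
      (fun x => ENNReal.ofReal (‖(f.derivative.eval x)⁻¹‖ ^ 2) * g x)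
  constructor
  · refine (Finset.measurable_fun_sum (Finset.range D) fun k _ => hm k).aemeasurable.congr ?_
    refine (ae_restrict_iff' hU).2 (Eventually.of_forall fun y hy => ?_)
    exact (heq y hy).symm
  · rw [setLIntegral_congr_fun hU heq, lintegral_finsetSum _ fun k _ => hm k]
    have hk : ∀ k, ∫⁻ y in slit α v,
        ENNReal.ofReal (‖(f.derivative.eval (branch D α z₀ v k y))⁻¹‖ ^ 2) *
          g (branch D α z₀ v k y) = ∫⁻ x in branch D α z₀ v k '' slit α v, g x := by
      intro k
      rw [lintegral_image_eq_lintegral_abs_det_fderiv_mul volume hU (hder k) (hinj k)]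
      simp_rw [abs_det_restrictScalars_toSpanSingleton]
    rw [Finset.sum_congr rfl fun k _ => hk k, ← lintegral_biUnion_finset]
    · exact setLIntegral_le_lintegral _ _
    · intro i hi j hj hij
      exact disjoint_branch_image hD hα (by simpa using hi) (by simpa using hj) hij
    · exact fun k _ => measurable_image_of_fderivWithin hU (hder k) (hinj k)

theorem ae_mem_slit (hα : α ≠ 0) : ∀ᵐ y : ℂ, y ∈ slit α v := by
  have h0 : volume {w : ℂ | w ∉ Complex.slitPlane} = 0 := by
    have h1 : volume ((LinearMap.ker Complex.imLm : Submodule ℝ ℂ) : Set ℂ) = 0 := by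
      refine Measure.addHaar_submodule _ _ ?_
      intro htop
      have : Complex.I ∈ LinearMap.ker Complex.imLm := htop ▸ Submodule.mem_top
      simp at this
    refine measure_mono_null (fun w hw => ?_) h1
    rw [Set.mem_ofPred_eq, Complex.mem_slitPlane_iff, not_or, not_not] at hw
    simpa using hw.2
  have h2 := addHaar_image_eq_zero_of_differentiableOn_of_addHaar_eq_zero volume
    (f := fun w : ℂ => v + α * w) (s := {w : ℂ | w ∉ Complex.slitPlane}) (by fun_prop) h0
  rw [ae_iff]
  refine measure_mono_null (fun y hy => ?_) h2
  refine ⟨(y - v) / α, hy, ?_⟩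
  field_simp
  ring

end Branches

/-- If `f_* q = ev • q` with `‖ev‖ ≥ 1`, there is no cancellation in the sums over the fibres. -/
theorem ae_norm_sum_eq_sum_norm {D : ℕ} {α z₀ v : ℂ} (hD : 2 ≤ D) (hα : α ≠ 0) {ρ : ℂ →₀ ℂ}
    (hρ : ρ ∈ residues Set.univ) {ev : ℂ} (hev : 1 ≤ ‖ev‖)
    (h : residueMap (unicritical D α z₀ v) v ρ = ev • ρ) :
    ∀ᵐ y : ℂ, ‖∑ x ∈ (unicritical D α z₀ v - C y).roots.toFinset,
        ofResidues ρ x / ((unicritical D α z₀ v).derivative.eval x) ^ 2‖ =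
      ∑ x ∈ (unicritical D α z₀ v - C y).roots.toFinset,
        ‖ofResidues ρ x / ((unicritical D α z₀ v).derivative.eval x) ^ 2‖ := by
  set f := unicritical D α z₀ v with hf
  set q : ℂ → ℂ := ofResidues ρ with hq
  have hint : ∫⁻ y, ‖q y‖ₑ ≠ ⊤ := (integrable_ofResidues hρ).2.ne
  have hpush : ∀ᵐ y : ℂ, pushforwardFun f q y = ev * q y := by
    have h1 := pushforward_ofResidues (v := v) (z₀ := z₀) hD hα ρ
    rw [h, map_smul] at h1
    have h2 : pushforwardFun f q =ᶠ[cofinite] ev • q := Germ.coe_eq.1 h1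
    have h3 : {y | ¬ pushforwardFun f q y = ev * q y}.Finite := h2
    exact h3.measure_zero volume
  set G : ℂ → ℝ≥0∞ := fun y => ∑ x ∈ (f - C y).roots.toFinset,
    ENNReal.ofReal (‖(f.derivative.eval x)⁻¹‖ ^ 2) * ‖q x‖ₑ with hG
  have hGn : ∀ y, G y =
      ENNReal.ofReal (∑ x ∈ (f - C y).roots.toFinset, ‖q x / (f.derivative.eval x) ^ 2‖) := by
    intro y
    rw [ENNReal.ofReal_sum_of_nonneg fun _ _ => norm_nonneg _]
    refine Finset.sum_congr rfl fun x _ => ?_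
    rw [← ofReal_norm, ← ENNReal.ofReal_mul (by positivity), norm_div, norm_pow, norm_inv,
      inv_pow, div_eq_inv_mul]
  obtain ⟨hGm, hGint⟩ := lintegral_sum_branch_le (D := D) (α := α) (z₀ := z₀) (v := v)
    (g := fun x => ‖q x‖ₑ) (by omega) hα (measurable_ofResidues ρ).enorm
  have hslit : volume.restrict (slit α v) = volume :=
    Measure.restrict_eq_self_of_ae_mem (ae_mem_slit hα)
  rw [hslit] at hGm hGint
  have hle : ∀ᵐ y : ℂ, ‖q y‖ ≤
      ‖∑ x ∈ (f - C y).roots.toFinset, q x / (f.derivative.eval x) ^ 2‖ := by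
    filter_upwards [hpush] with y hy
    change ∑ x ∈ (f - C y).roots.toFinset, q x / (f.derivative.eval x) ^ 2 = ev * q y at hy
    rw [hy, norm_mul]
    exact le_mul_of_one_le_left (norm_nonneg _) hev
  have hle' : (fun y => ‖q y‖ₑ) ≤ᵐ[volume] G := by
    filter_upwards [hle] with y hy
    rw [hGn, ← ofReal_norm]
    exact ENNReal.ofReal_le_ofReal (hy.trans (norm_sum_le _ _))
  have haeeq := ae_eq_of_ae_le_of_lintegral_le hle' hint hGm hGint
  filter_upwards [haeeq, hle] with y hy hy'
  refine le_antisymm (norm_sum_le _ _) (le_trans (le_of_eq ?_) hy')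
  rw [hGn, ← ofReal_norm] at hy
  exact ((ENNReal.ofReal_eq_ofReal_iff (norm_nonneg _)
    (Finset.sum_nonneg fun _ _ => norm_nonneg _)).1 hy).symm

/-! ### Strict contraction -/

theorem im_div_eq_zero_of_norm_add {x y : ℂ} (h : ‖x + y‖ = ‖x‖ + ‖y‖) : (y / x).im = 0 := by
  rcases sameRay_iff_norm_add.2 h with rfl | rfl | ⟨r, s, hr, hs, e⟩
  · simp
  · simp
  · by_cases hx : x = 0
    · simp [hx]
    have hs' : (s : ℂ) ≠ 0 := by exact_mod_cast hs.ne'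
    have e' : (r : ℂ) * x = s * y := by simpa using e
    have : y / x = ((r / s : ℝ) : ℂ) := by
      push_cast
      rw [div_eq_div_iff hx hs', mul_comm y, e']
    rw [this, Complex.ofReal_im]

theorem norm_add_eq_of_norm_sum_eq {ι : Type*} [DecidableEq ι] {s : Finset ι} {t : ι → ℂ} {i j : ι}
    (hi : i ∈ s) (hj : j ∈ s) (hij : i ≠ j) (h : ‖∑ k ∈ s, t k‖ = ∑ k ∈ s, ‖t k‖) :
    ‖t i + t j‖ = ‖t i‖ + ‖t j‖ := by
  refine le_antisymm (norm_add_le _ _) ?_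
  have hj' : j ∈ s.erase i := Finset.mem_erase.2 ⟨hij.symm, hj⟩
  rw [← Finset.add_sum_erase s t hi, ← Finset.add_sum_erase s (fun k => ‖t k‖) hi,
    ← Finset.add_sum_erase _ t hj', ← Finset.add_sum_erase _ (fun k => ‖t k‖) hj', ← add_assoc] at h
  have h1 := norm_add_le (t i + t j) (∑ k ∈ (s.erase i).erase j, t k)
  have h2 := norm_sum_le ((s.erase i).erase j) t
  linarith

theorem isOpenMap_unicritical {D : ℕ} {α z₀ v : ℂ} (hD : D ≠ 0) (hα : α ≠ 0) :
    IsOpenMap fun z => (unicritical D α z₀ v).eval z := by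
  have han : AnalyticOnNhd ℂ (fun z => (unicritical D α z₀ v).eval z) Set.univ := fun z _ =>
    (unicritical D α z₀ v).differentiable.analyticAt z
  rcases han.is_constant_or_isOpen isPreconnected_univ with ⟨w, hw⟩ | h
  · exfalso
    have h0 := hw z₀ trivial
    have h1 := hw (z₀ + 1) trivial
    simp only [eval_unicritical, sub_self, zero_pow hD, mul_zero, zero_add, add_sub_cancel_left,
      one_pow, mul_one] at h0 h1
    exact hα (by rw [← h0] at h1; simpa using h1)
  · exact fun s hs => h s (Set.subset_univ s) hs

/-- An analytic function that is real on a dense set is locally constant. -/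
theorem eventually_eq_of_dense_im_eq_zero {h : ℂ → ℂ} {a : ℂ} (hh : AnalyticAt ℂ h a) {S : Set ℂ}
    (hS : Dense S) (hreal : ∀ᶠ x in 𝓝 a, x ∈ S → (h x).im = 0) : ∀ᶠ x in 𝓝 a, h x = h a := by
  have hreal' : ∀ᶠ x in 𝓝 a, (h x).im = 0 := by
    filter_upwards [hh.eventually_analyticAt, hreal.eventually_nhds] with x hx hx'
    by_contra hne
    have h1 : ∀ᶠ y in 𝓝 x, (h y).im ≠ 0 :=
      (Complex.continuous_im.continuousAt.comp hx.continuousAt).eventually_ne hne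
    obtain ⟨y, hyS, hy1, hy2⟩ := hS.inter_nhds_nonempty (h1.and hx')
    exact hy1 (hy2 hyS)
  rcases hh.eventually_constant_or_nhds_le_map_nhds with hc | hopen
  · exact hc
  · exfalso
    have h1 : ∀ᶠ w in 𝓝 (h a), w.im = 0 := hopen hreal'
    have h2 : Tendsto (fun t : ℝ => h a + t * Complex.I) (𝓝[>] 0) (𝓝 (h a)) := by
      have : Tendsto (fun t : ℝ => h a + t * Complex.I) (𝓝 0) (𝓝 (h a + (0 : ℝ) * Complex.I)) := by
        exact Continuous.tendsto (by fun_prop) 0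
      rw [Complex.ofReal_zero, zero_mul, add_zero] at this
      exact this.mono_left nhdsWithin_le_nhds
    obtain ⟨t, ht, ht0⟩ := ((h2.eventually h1).and self_mem_nhdsWithin).exists
    have ha0 : (h a).im = 0 := hreal'.self_of_nhds
    simp only [Complex.add_im, Complex.mul_im, Complex.ofReal_re, Complex.I_im, mul_one,
      Complex.ofReal_im, Complex.I_re, mul_zero, add_zero, ha0, zero_add] at ht
    exact (ne_of_gt ht0) ht

theorem eq_zero_of_frequently_ofResidues {ρ : ℂ →₀ ℂ} {a : ℂ} (ha : ρ a = 0)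
    (h : ∃ᶠ z in 𝓝[≠] a, ofResidues ρ z = 0) : ρ = 0 := by
  have han : AnalyticOnNhd ℂ (ofResidues ρ) (ρ.support : Set ℂ)ᶜ := fun z hz =>
    analyticAt_ofResidues (by simpa using hz)
  have hconn : IsPreconnected ((ρ.support : Set ℂ)ᶜ) :=
    (Set.Countable.isPathConnected_compl_of_one_lt_rank (by simp [Complex.rank_real_complex])
      ρ.support.countable_toSet).isConnected.isPreconnected
  have h1 := han.eqOn_zero_of_preconnected_of_frequently_eq_zero hconn
    (show a ∈ (ρ.support : Set ℂ)ᶜ by simpa using ha) h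
  refine eq_zero_of_ofResidues ?_
  have h2 : (ρ.support : Set ℂ)ᶜ ∈ cofinite := ρ.support.finite_toSet.compl_mem_cofinite
  filter_upwards [h2] with z hz using h1 hz

/-- The operator `f_*` strictly decreases the area. In the equality case, the summands over a fibre
have the same argument. Let `a ≠ z₀` be a pole whose image `a'` under the rotation of order `D`
around `z₀` is not a pole. The quotient of the summands at `a'` and `a` extends analytically near
`a`, is real and vanishes at `a`; so it vanishes identically, and so does `q` near `a'`. -/
theorem norm_lt_one_of_residueMap_eq {D : ℕ} {α z₀ v : ℂ} (hD : 2 ≤ D) (hα : α ≠ 0) {ρ : ℂ →₀ ℂ}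
    (hρ : ρ ∈ residues Set.univ) {ev : ℂ}
    (h : residueMap (unicritical D α z₀ v) v ρ = ev • ρ) {a : ℂ} (ha : ρ a ≠ 0) (haz : a ≠ z₀)
    (hinj : ∀ a', ρ a' ≠ 0 → (unicritical D α z₀ v).eval a' = (unicritical D α z₀ v).eval a →
      a' = a) : ‖ev‖ < 1 := by
  classical
  by_contra! hev
  set f := unicritical D α z₀ v with hf
  set ζ := Complex.exp (2 * Real.pi * Complex.I / D) with hζdef
  have hζ : IsPrimitiveRoot ζ D := Complex.isPrimitiveRoot_exp D (by omega)
  have hζ0 : ζ ≠ 0 := hζ.ne_zero (by omega)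
  have hζ1 : ζ ≠ 1 := hζ.ne_one (by omega)
  set rot : ℂ → ℂ := fun x => z₀ + ζ * (x - z₀) with hrot
  have hrotne : ∀ x, x ≠ z₀ → rot x ≠ x := by
    intro x hx hcon
    have : (ζ - 1) * (x - z₀) = 0 := by
      simp only [hrot] at hcon
      linear_combination hcon
    rcases mul_eq_zero.1 this with h1 | h1
    · exact hζ1 (sub_eq_zero.1 h1)
    · exact hx (sub_eq_zero.1 h1)
  have hevalrot : ∀ x, f.eval (rot x) = f.eval x := by
    intro x
    simp only [hf, hrot, eval_unicritical, add_sub_cancel_left, mul_pow, hζ.pow_eq_one, one_mul]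
  have hderrot : ∀ x, f.derivative.eval (rot x) = ζ ^ (D - 1) * f.derivative.eval x := by
    intro x
    simp only [hf, hrot, eval_derivative_unicritical, add_sub_cancel_left, mul_pow]
    ring
  have hrota : ρ (rot a) = 0 := by
    by_contra hne
    exact hrotne a haz (hinj _ hne (hevalrot a))
  set G : ℂ → ℂ := fun x => ρ a + (x - a) * ofResidues (ρ.erase a) x with hG
  have hGan : AnalyticAt ℂ G a :=
    analyticAt_const.add ((analyticAt_id.sub analyticAt_const).mul
      (analyticAt_ofResidues (by simp)))
  have hGa : G a ≠ 0 := by simpa [hG] using ha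
  have hqG : ∀ x, x ≠ a → ofResidues ρ x = G x / (x - a) := by
    intro x hx
    have : x - a ≠ 0 := sub_ne_zero.2 hx
    rw [ofResidues_eq_add ρ a x]
    simp only [hG]
    field_simp
  set k : ℂ → ℂ := fun x => ofResidues ρ (rot x) * (x - a) / (G x * (ζ ^ (D - 1)) ^ 2) with hk
  have hrotan : AnalyticAt ℂ rot a :=
    analyticAt_const.add (analyticAt_const.mul (analyticAt_id.sub analyticAt_const))
  have hζp : (ζ ^ (D - 1)) ^ 2 ≠ 0 := pow_ne_zero _ (pow_ne_zero _ hζ0)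
  have hkan : AnalyticAt ℂ k a := by
    refine AnalyticAt.div (AnalyticAt.mul ?_ (analyticAt_id.sub analyticAt_const))
      (hGan.mul analyticAt_const) (mul_ne_zero hGa hζp)
    exact (analyticAt_ofResidues hrota).comp hrotan
  have hka : k a = 0 := by simp [hk]
  have hdense := (Measure.dense_of_ae (ae_norm_sum_eq_sum_norm hD hα hρ hev h)).preimage
    (isOpenMap_unicritical (z₀ := z₀) (v := v) (show D ≠ 0 by omega) hα)
  obtain ⟨S, hS, hSdense⟩ : ∃ S : Set ℂ, (∀ x ∈ S, (x ≠ a ∧ x ≠ z₀) ∧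
      ‖∑ y ∈ (f - C (f.eval x)).roots.toFinset, ofResidues ρ y / (f.derivative.eval y) ^ 2‖ =
        ∑ y ∈ (f - C (f.eval x)).roots.toFinset,
          ‖ofResidues ρ y / (f.derivative.eval y) ^ 2‖) ∧ Dense S :=
    ⟨_, fun x hx => ⟨by simpa using hx.2, hx.1⟩, hdense.sdiff_finset {a, z₀}⟩
  have hGne : ∀ᶠ x in 𝓝 a, G x ≠ 0 := hGan.continuousAt.eventually_ne hGa
  have hreal : ∀ᶠ x in 𝓝 a, x ∈ S → (k x).im = 0 := by
    filter_upwards [hGne] with x hGx hx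
    obtain ⟨hxa', hx⟩ := hS x hx
    have hne : f - C (f.eval x) ≠ 0 := by
      intro h0
      have h1 := congrArg (fun p : ℂ[X] => p.derivative.eval x) h0
      simp only [derivative_sub, derivative_C, sub_zero, derivative_zero, eval_zero] at h1
      rw [hf, eval_derivative_unicritical] at h1
      have hD0 : (D : ℂ) ≠ 0 := by exact_mod_cast (by omega : D ≠ 0)
      exact mul_ne_zero (mul_ne_zero hD0 hα) (pow_ne_zero _ (sub_ne_zero.2 hxa'.2)) h1
    have hmem : ∀ y, f.eval y = f.eval x → y ∈ (f - C (f.eval x)).roots.toFinset := by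
      intro y hy
      rw [Multiset.mem_toFinset, mem_roots hne]
      simp [hy]
    have hsum := norm_add_eq_of_norm_sum_eq (hmem x rfl) (hmem (rot x) (hevalrot x))
      (hrotne x hxa'.2).symm hx
    have him := im_div_eq_zero_of_norm_add hsum
    have hd : f.derivative.eval x ≠ 0 := by
      rw [hf, eval_derivative_unicritical]
      have hD0 : (D : ℂ) ≠ 0 := by exact_mod_cast (by omega : D ≠ 0)
      exact mul_ne_zero (mul_ne_zero hD0 hα) (pow_ne_zero _ (sub_ne_zero.2 hxa'.2))
    have e : ofResidues ρ (rot x) / f.derivative.eval (rot x) ^ 2 /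
        (ofResidues ρ x / f.derivative.eval x ^ 2) = k x := by
      rw [hderrot, hqG x hxa'.1]
      simp only [hk]
      have h1 : x - a ≠ 0 := sub_ne_zero.2 hxa'.1
      have h2 : ζ ^ (D - 1) ≠ 0 := pow_ne_zero _ hζ0
      field_simp
    rw [← e]
    exact him
  have hk0 := eventually_eq_of_dense_im_eq_zero hkan hSdense hreal
  rw [hka] at hk0
  have hq0 : ∀ᶠ x in 𝓝[≠] a, ofResidues ρ (rot x) = 0 := by
    filter_upwards [mem_nhdsWithin_of_mem_nhds hk0, mem_nhdsWithin_of_mem_nhds hGne,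
      self_mem_nhdsWithin] with x hx hGx hxa
    have hxa' : x - a ≠ 0 := sub_ne_zero.2 hxa
    have hx' : ofResidues ρ (rot x) * (x - a) / (G x * (ζ ^ (D - 1)) ^ 2) = 0 := hx
    simpa [hxa', hGx, hζ0] using hx'
  have htend : Tendsto rot (𝓝[≠] a) (𝓝[≠] (rot a)) := by
    refine tendsto_nhdsWithin_of_tendsto_nhds_of_eventually_within _
      (hrotan.continuousAt.tendsto.mono_left nhdsWithin_le_nhds) ?_
    filter_upwards [self_mem_nhdsWithin] with x hx hcon
    refine hx ?_
    simp only [hrot, Set.mem_singleton_iff, add_right_inj, mul_right_inj' hζ0] at hcon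
    exact sub_left_injective hcon
  have hfreq : ∃ᶠ z in 𝓝[≠] (rot a), ofResidues ρ z = 0 := htend.frequently hq0.frequently
  exact ha (by rw [eq_zero_of_frequently_ofResidues hrota hfreq]; rfl)

end QuadDiff

namespace QuadDiff

/-! ### The postcritical set -/

section Postcritical

variable {D : ℕ} {α z₀ v : ℂ}

theorem iterate_sphereMap_coe (f : ℂ[X]) (n : ℕ) (z : ℂ) :
    (sphereMap f)^[n] (z : OnePoint ℂ) = (((fun z => f.eval z)^[n] z : ℂ) : OnePoint ℂ) := by
  induction n with
  | zero => rfl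
  | succ n ih => rw [Function.iterate_succ_apply', Function.iterate_succ_apply', ih]; rfl

theorem iterate_sphereMap_infty (f : ℂ[X]) (n : ℕ) :
    (sphereMap f)^[n] OnePoint.infty = OnePoint.infty := by
  induction n with
  | zero => rfl
  | succ n ih => rw [Function.iterate_succ_apply', ih]; rfl

theorem infty_mem_postcriticalSet {f : ℂ[X]} (hf : 2 ≤ f.natDegree) :
    OnePoint.infty ∈ postcriticalSet f := by
  rw [postcriticalSet, Set.mem_iUnion₂]
  exact ⟨1, le_rfl, OnePoint.infty, hf, iterate_sphereMap_infty f 1⟩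

theorem coe_mem_postcriticalSet_iff {f : ℂ[X]} (hcrit : ∀ z : ℂ, f.derivative.eval z = 0 ↔ z = z₀)
    {a : ℂ} : (a : OnePoint ℂ) ∈ postcriticalSet f ↔
      ∃ n, (fun z => f.eval z)^[n] (f.eval z₀) = a := by
  rw [postcriticalSet, Set.mem_iUnion₂]
  constructor
  · rintro ⟨n, hn, x, hx, hxa⟩
    obtain ⟨k, rfl⟩ : ∃ k, n = k + 1 := ⟨n - 1, by omega⟩
    induction x using OnePoint.rec with
    | infty =>
      rw [iterate_sphereMap_infty] at hxa
      exact absurd hxa (OnePoint.infty_ne_coe a)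
    | coe z =>
      have hz : z = z₀ := (hcrit z).1 hx
      rw [iterate_sphereMap_coe, OnePoint.coe_eq_coe, Function.iterate_succ_apply, hz] at hxa
      exact ⟨k, hxa⟩
  · rintro ⟨n, hn⟩
    refine ⟨n + 1, by omega, z₀, (hcrit z₀).2 rfl, ?_⟩
    rw [iterate_sphereMap_coe, OnePoint.coe_eq_coe, Function.iterate_succ_apply]
    exact hn

theorem finite_setOf_iterate_eq {F : ℂ → ℂ} {v : ℂ} (hv : v ∈ Function.periodicPts F) :
    {a | ∃ n, F^[n] v = a}.Finite := by
  have hp := Function.minimalPeriod_pos_of_mem_periodicPts hv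
  refine ((Set.finite_Iio (Function.minimalPeriod F v)).image fun n => F^[n] v).subset ?_
  rintro _ ⟨n, rfl⟩
  exact ⟨n % _, Nat.mod_lt _ hp, Function.iterate_mod_minimalPeriod_eq⟩

end Postcritical

/-! ### Eigenvalues -/

theorem ofResidues_injective {ρ σ : ℂ →₀ ℂ}
    (h : ((ofResidues ρ : ℂ → ℂ) : Coeff) = ((ofResidues σ : ℂ → ℂ) : Coeff)) : ρ = σ := by
  rw [← sub_eq_zero]
  refine eq_zero_of_ofResidues ?_
  filter_upwards [Germ.coe_eq.1 h] with z hz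
  simp [hz]

theorem finiteDimensional_residues {X : Set ℂ} (hX : X.Finite) :
    FiniteDimensional ℂ (residues X) := by
  have := hX.to_subtype
  have : FiniteDimensional ℂ (Finsupp.supported ℂ ℂ X) :=
    Module.Finite.equiv (Finsupp.supportedEquivFinsupp X).symm
  exact Submodule.finiteDimensional_of_le (inf_le_left : residues X ≤ Finsupp.supported ℂ ℂ X)

/-- An eigenvector modulo a finite-dimensional invariant subspace `W`, for an eigenvalue which does
not occur on `W`, can be corrected by an element of `W` to an eigenvector. -/
theorem exists_correction {V : Type*} [AddCommGroup V] [Module ℂ V] (T : V →ₗ[ℂ] V)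
    (W : Submodule ℂ V) [FiniteDimensional ℂ W] (hW : ∀ w ∈ W, T w ∈ W) {ev : ℂ}
    (hev : ∀ w ∈ W, T w = ev • w → w = 0) {x : V} (hx : T x - ev • x ∈ W) :
    ∃ w ∈ W, T (x - w) = ev • (x - w) := by
  let S : W →ₗ[ℂ] W := T.restrict hW - ev • LinearMap.id
  have hS : ∀ w : W, ((S w : W) : V) = T w - ev • (w : V) := fun w => rfl
  have hinj : Function.Injective S := by
    rw [injective_iff_map_eq_zero]
    intro w hw
    refine Subtype.ext (hev w w.2 (sub_eq_zero.1 ?_))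
    rw [← hS, hw]
    rfl
  obtain ⟨w, hw⟩ := LinearMap.surjective_of_injective hinj ⟨_, hx⟩
  have h1 := congrArg Subtype.val hw
  rw [hS] at h1
  refine ⟨w, w.2, ?_⟩
  rw [map_sub, smul_sub, sub_eq_sub_iff_sub_eq_sub]
  exact h1.symm

section Eigenvalues

variable {D : ℕ} {α z₀ v ev : ℂ}

theorem derivative_unicritical_eq_zero_iff (hD : 2 ≤ D) (hα : α ≠ 0) (z : ℂ) :
    (unicritical D α z₀ v).derivative.eval z = 0 ↔ z = z₀ := by
  have hD0 : (D : ℂ) ≠ 0 := by exact_mod_cast (by omega : D ≠ 0)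
  rw [eval_derivative_unicritical, mul_eq_zero, or_iff_right (mul_ne_zero hD0 hα),
    pow_eq_zero_iff (by omega), sub_eq_zero]

theorem eval_unicritical_self (hD : D ≠ 0) : (unicritical D α z₀ v).eval z₀ = v := by
  simp [hD]

theorem periodic_of_iterate {F : ℂ → ℂ} {v a : ℂ} (hv : v ∈ Function.periodicPts F)
    (ha : ∃ n, F^[n] v = a) : a ∈ Function.periodicPts F := by
  obtain ⟨n, rfl⟩ := ha
  exact ((Function.bijOn_periodicPts F).mapsTo.iterate n) hv

theorem arithmetic_of_poles_in_orbit (hD : 2 ≤ D) (hα : α ≠ 0)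
    (hz₀ : z₀ ∈ Function.periodicPts fun z => (unicritical D α z₀ v).eval z) {ρ : ℂ →₀ ℂ}
    (hρ : ρ ∈ residues {a | ∃ n, (fun z => (unicritical D α z₀ v).eval z)^[n] v = a}) (hρ0 : ρ ≠ 0)
    (h : residueMap (unicritical D α z₀ v) v ρ = ev • ρ) :
    IsAlgebraicUnit (D * ev) ∧ 1 / 4 < ‖(D : ℂ) * ev‖ := by
  set f := unicritical D α z₀ v with hf
  have hv : v ∈ Function.periodicPts fun z => f.eval z := by
    have h1 := (Function.bijOn_periodicPts fun z => f.eval z).mapsTo hz₀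
    rwa [hf, eval_unicritical_self (by omega)] at h1
  rw [mem_residues] at hρ
  obtain ⟨n, a, hn, ha, hsum⟩ := exists_sum_eq_zero_of_residueMap_eq f hv (fun z hz => by
    rw [(derivative_unicritical_eq_zero_iff hD hα z).1 hz]
    exact eval_unicritical_self (by omega)) hρ0 hρ.1 hρ.2.1 h
  choose! s hs using fun j (hj : j + 1 < n) =>
    derivative_eq_mul_unit_of_mem_periodicPts hD hα hz₀ (ha j hj).1 (ha j hj).2
  have hsum' : ∑ i ∈ Finset.range n, (D * ev) ^ i * ∏ j ∈ Finset.range i, s j = 0 := by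
    rw [← hsum]
    refine Finset.sum_congr rfl fun i hi => ?_
    rw [Finset.prod_congr rfl fun j hj => (hs j (by
      have := Finset.mem_range.1 hi; have := Finset.mem_range.1 hj; omega)).1,
      Finset.prod_mul_distrib, Finset.prod_const, Finset.card_range, mul_pow]
    ring
  exact ⟨isAlgebraicUnit_of_sum_pow_mul_prod_eq_zero hn (fun j hj => (hs j hj).2.1) hsum',
    quarter_lt_norm_of_sum_pow_mul_prod_eq_zero hn (fun j hj => (hs j hj).2.2) hsum'⟩

theorem arithmetic_of_pole_notMem (hD : 2 ≤ D) (hα : α ≠ 0)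
    (hz₀ : z₀ ∈ Function.periodicPts fun z => (unicritical D α z₀ v).eval z) {P : Set ℂ}
    (hv : v ∈ P) (hP : ∀ z ∈ P, (unicritical D α z₀ v).eval z ∈ P) (hev : ev ≠ 0) {ρ : ℂ →₀ ℂ}
    (h : ∀ b ∉ P, residueMap (unicritical D α z₀ v) v ρ b = ev * ρ b) {b : ℂ} (hb : b ∉ P)
    (hρb : ρ b ≠ 0) : IsAlgebraicUnit (D * ev) ∧ 1 / 2 ≤ ‖(D : ℂ) * ev‖ := by
  set f := unicritical D α z₀ v with hf
  obtain ⟨m, hm, hper, hprod⟩ := exists_cycle_of_residueMap_eq f hv hP hev h hb hρb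
  have hbper : b ∈ Function.periodicPts fun z => f.eval z := ⟨m, hm, hper⟩
  have hne : ∀ i < m, f.derivative.eval ((fun z => f.eval z)^[i] b) ≠ 0 := by
    intro i hi h0
    rw [Finset.prod_eq_zero (Finset.mem_range.2 hi) h0, mul_zero] at hprod
    exact zero_ne_one hprod
  choose! s hs using fun i (hi : i < m) =>
    derivative_eq_mul_unit_of_mem_periodicPts hD hα hz₀
      (periodic_of_iterate hbper ⟨i, rfl⟩) (hne i hi)
  have hprod' : (D * ev) ^ m * ∏ i ∈ Finset.range m, s i = 1 := by
    rw [← hprod, Finset.prod_congr rfl fun i hi => (hs i (Finset.mem_range.1 hi)).1,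
      Finset.prod_mul_distrib, Finset.prod_const, Finset.card_range, mul_pow]
    ring
  exact ⟨isAlgebraicUnit_of_pow_mul_prod_eq_one hm (fun i hi => (hs i hi).2.1) hprod',
    half_le_norm_of_pow_mul_prod_eq_one hm (fun i hi => (hs i hi).2.2) hprod'⟩

theorem norm_lt_one_of_eigenvector (hD : 2 ≤ D) (hα : α ≠ 0)
    (hz₀ : z₀ ∈ Function.periodicPts fun z => (unicritical D α z₀ v).eval z) (hev : ev ≠ 0)
    {ρ : ℂ →₀ ℂ} (hρ : ρ ∈ residues Set.univ) (hρ0 : ρ ≠ 0)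
    (h : residueMap (unicritical D α z₀ v) v ρ = ev • ρ) : ‖ev‖ < 1 := by
  set f := unicritical D α z₀ v with hf
  set F : ℂ → ℂ := fun z => f.eval z with hF
  have hv : v ∈ Function.periodicPts F := by
    have h1 := (Function.bijOn_periodicPts F).mapsTo hz₀
    have h2 : f.eval z₀ = v := eval_unicritical_self (by omega)
    simpa only [hF, h2] using h1
  -- Every pole is periodic, hence `f` is injective on the set of poles.
  have hper : ∀ a, ρ a ≠ 0 → a ∈ Function.periodicPts F := by
    intro a ha
    by_contra hna
    obtain ⟨m, hm, hm', -⟩ := exists_cycle_of_residueMap_eq f (P := Function.periodicPts F) hv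
      (fun z hz => (Function.bijOn_periodicPts F).mapsTo hz) hev
      (fun b _ => by rw [h]; rfl) hna ha
    exact hna ⟨m, hm, hm'⟩
  -- A single pole at `z₀` is impossible, since the residues have sum zero.
  obtain ⟨a, ha, haz⟩ : ∃ a, ρ a ≠ 0 ∧ a ≠ z₀ := by
    by_contra! hcon
    have hsum := (mem_residues.1 hρ).2.1
    rw [Finset.sum_subset (s₂ := {z₀})
      (fun a ha => by simpa using hcon a (by simpa using ha)) (fun a _ ha => by simpa using ha),
      Finset.sum_singleton] at hsum
    refine hρ0 (Finsupp.ext fun a => ?_)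
    by_contra hne
    exact hne (hcon a hne ▸ hsum)
  exact norm_lt_one_of_residueMap_eq hD hα hρ h ha haz fun a' ha' haa' =>
    (Function.bijOn_periodicPts F).injOn (hper a' ha') (hper a ha) haa'

end Eigenvalues

end QuadDiff

open QuadDiff in
theorem theorem3 (D : ℕ) (hD : 2 ≤ D) (f : ℂ[X]) (hf : f.natDegree = D) (z₀ : ℂ)
    (hcrit : ∀ z : ℂ, f.derivative.eval z = 0 ↔ z = z₀)
    (hper : z₀ ∈ Function.periodicPts (fun z : ℂ => f.eval z)) :
    ∃ (hQ : ∀ q ∈ QuadDiff.sphere, QuadDiff.pushforward f q ∈ QuadDiff.sphere)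
      (hP : ∀ q ∈ QuadDiff.postcritical f,
        QuadDiff.pushforward f q ∈ QuadDiff.postcritical f),
      (∀ ev : ℂ, ev ≠ 0 →
        Module.End.HasEigenvalue ((QuadDiff.pushforward f).restrict hQ) ev →
        IsAlgebraicUnit (D * ev) ∧ 1 / (4 * D : ℝ) < ‖ev‖ ∧ ‖ev‖ < 1) ∧
      (∀ ev : ℂ,
        Module.End.HasEigenvalue ((QuadDiff.pushforward f).restrict hP) ev →
        IsAlgebraicUnit (D * ev) ∧ 1 / (4 * D : ℝ) < ‖ev‖ ∧ ‖ev‖ < 1) ∧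
      (∀ ev : ℂ, ev ≠ 0 →
        Module.End.HasEigenvalue (inducedOnQuotient (QuadDiff.pushforward f)
          QuadDiff.sphere (QuadDiff.postcritical f) hQ hP) ev →
        IsAlgebraicUnit (D * ev) ∧ 1 / (2 * D : ℝ) ≤ ‖ev‖ ∧ ‖ev‖ < 1) := by
  obtain ⟨α, v, hα, rfl⟩ := exists_eq_unicritical hD hf hcrit
  set f := unicritical D α z₀ v with hfdef
  set F : ℂ → ℂ := fun z => f.eval z with hF
  set P : Set ℂ := {a | ∃ n, F^[n] v = a} with hPdef
  have hfv : f.eval z₀ = v := eval_unicritical_self (by omega)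
  have hv : v ∈ Function.periodicPts F := by
    have h1 := (Function.bijOn_periodicPts F).mapsTo hper
    simpa only [hF, hfv] using h1
  have hvP : v ∈ P := ⟨0, rfl⟩
  have hPinv : ∀ z ∈ P, f.eval z ∈ P := by
    rintro _ ⟨n, rfl⟩
    exact ⟨n + 1, Function.iterate_succ_apply' F n v⟩
  have hPeq : {a : ℂ | (a : OnePoint ℂ) ∈ postcriticalSet f} = P := by
    ext a
    rw [Set.mem_ofPred_eq, coe_mem_postcriticalSet_iff hcrit, hfv]
    rfl
  have hinfty : OnePoint.infty ∈ postcriticalSet f := infty_mem_postcriticalSet (hf ▸ hD)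
  have hmemS : ∀ g : Coeff, g ∈ sphere ↔
      ∃ ρ ∈ residues Set.univ, ((ofResidues ρ : ℂ → ℂ) : Coeff) = g := fun g =>
    mem_polesIn_iff (Set.mem_univ _)
  have hmemP : ∀ g : Coeff, g ∈ postcritical f ↔
      ∃ ρ ∈ residues P, ((ofResidues ρ : ℂ → ℂ) : Coeff) = g := fun g => by
    rw [mem_polesIn_iff hinfty, hPeq]
  have hpush : ∀ ρ, pushforward f ((ofResidues ρ : ℂ → ℂ) : Coeff) =
      ((ofResidues (residueMap f v ρ) : ℂ → ℂ) : Coeff) := pushforward_ofResidues hD hα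
  have hsmul : ∀ (c : ℂ) (ρ : ℂ →₀ ℂ), c • ((ofResidues ρ : ℂ → ℂ) : Coeff) =
      ((ofResidues (c • ρ) : ℂ → ℂ) : Coeff) := fun c ρ => by rw [map_smul]; rfl
  have hsub : ∀ ρ σ : ℂ →₀ ℂ, ((ofResidues ρ : ℂ → ℂ) : Coeff) - ((ofResidues σ : ℂ → ℂ) : Coeff) =
      ((ofResidues (ρ - σ) : ℂ → ℂ) : Coeff) := fun ρ σ => by rw [map_sub]; rfl
  have hresP : ∀ ρ ∈ residues P, residueMap f v ρ ∈ residues P := fun ρ hρ =>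
    residueMap_mem_residues hD hα hvP hPinv hρ
  have hle : residues P ≤ residues Set.univ := by
    intro ρ hρ
    rw [mem_residues] at hρ ⊢
    exact ⟨fun a _ => Set.mem_univ a, hρ.2⟩
  have hD0 : (0 : ℝ) < D := by exact_mod_cast (by omega : 0 < D)
  have hnorm : ∀ ev : ℂ, ‖(D : ℂ) * ev‖ = D * ‖ev‖ := fun ev => by simp
  have hquarter : ∀ ev : ℂ, 1 / 4 < ‖(D : ℂ) * ev‖ → 1 / (4 * D : ℝ) < ‖ev‖ := fun ev h => by
    rw [hnorm] at h
    rw [div_lt_iff₀ (by positivity)]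
    linarith
  have hhalf : ∀ ev : ℂ, 1 / 2 ≤ ‖(D : ℂ) * ev‖ → 1 / (2 * D : ℝ) ≤ ‖ev‖ := fun ev h => by
    rw [hnorm] at h
    rw [div_le_iff₀ (by positivity)]
    linarith
  have hQ : ∀ q ∈ sphere, pushforward f q ∈ sphere := by
    intro q hq
    obtain ⟨ρ, hρ, rfl⟩ := (hmemS q).1 hq
    exact (hmemS _).2 ⟨_, residueMap_mem_residues hD hα (Set.mem_univ _)
      (fun _ _ => Set.mem_univ _) hρ, (hpush ρ).symm⟩
  have hP : ∀ q ∈ postcritical f, pushforward f q ∈ postcritical f := by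
    intro q hq
    obtain ⟨ρ, hρ, rfl⟩ := (hmemP q).1 hq
    exact (hmemP _).2 ⟨_, hresP ρ hρ, (hpush ρ).symm⟩
  -- Eigenvectors with poles in the postcritical set.
  have hpost : ∀ (ev : ℂ) (ρ : ℂ →₀ ℂ), ρ ∈ residues P → ρ ≠ 0 → residueMap f v ρ = ev • ρ →
      IsAlgebraicUnit (D * ev) ∧ 1 / (4 * D : ℝ) < ‖ev‖ ∧ ‖ev‖ < 1 := by
    intro ev ρ hρ hρ0 h
    obtain ⟨h1, h2⟩ := arithmetic_of_poles_in_orbit hD hα hper hρ hρ0 h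
    exact ⟨h1, hquarter ev h2, norm_lt_one_of_eigenvector hD hα hper (right_ne_zero_of_mul h1.1)
      (hle hρ) hρ0 h⟩
  refine ⟨hQ, hP, fun ev hev h => ?_, fun ev h => ?_, fun ev hev h => ?_⟩
  · obtain ⟨⟨q, hq⟩, hvec⟩ := h.exists_hasEigenvector
    have h1 : pushforward f q = ev • q := congrArg Subtype.val hvec.apply_eq_smul
    have h2 : q ≠ 0 := fun h0 => hvec.2 (Subtype.ext h0)
    obtain ⟨ρ, hρ, rfl⟩ := (hmemS q).1 hq
    rw [hpush, hsmul] at h1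
    have h3 := ofResidues_injective h1
    have hρ0 : ρ ≠ 0 := by
      rintro rfl
      exact h2 (by rw [map_zero]; rfl)
    by_cases hall : ∀ a, ρ a ≠ 0 → a ∈ P
    · exact hpost ev ρ (mem_residues.2 ⟨hall, (mem_residues.1 hρ).2⟩) hρ0 h3
    · push Not at hall
      obtain ⟨b, hb, hbP⟩ := hall
      obtain ⟨h4, h5⟩ := arithmetic_of_pole_notMem hD hα hper hvP hPinv hev
        (fun b _ => by rw [h3]; rfl) hbP hb
      exact ⟨h4, hquarter ev (lt_of_lt_of_le (by norm_num) h5),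
        norm_lt_one_of_eigenvector hD hα hper hev hρ hρ0 h3⟩
  · obtain ⟨⟨q, hq⟩, hvec⟩ := h.exists_hasEigenvector
    have h1 : pushforward f q = ev • q := congrArg Subtype.val hvec.apply_eq_smul
    have h2 : q ≠ 0 := fun h0 => hvec.2 (Subtype.ext h0)
    obtain ⟨ρ, hρ, rfl⟩ := (hmemP q).1 hq
    rw [hpush, hsmul] at h1
    refine hpost ev ρ hρ ?_ (ofResidues_injective h1)
    rintro rfl
    exact h2 (by rw [map_zero]; rfl)
  · obtain ⟨x, hvec⟩ := h.exists_hasEigenvector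
    obtain ⟨⟨q, hq⟩, rfl⟩ := Submodule.Quotient.mk_surjective _ x
    have h1 := hvec.apply_eq_smul
    have h2 : pushforward f q - ev • q ∈ postcritical f :=
      (Submodule.Quotient.eq ((postcritical f).submoduleOf sphere)
        (x := (pushforward f).restrict hQ ⟨q, hq⟩) (y := ev • (⟨q, hq⟩ : sphere))).1 h1
    have h3 : q ∉ postcritical f := fun hmem =>
      hvec.2 ((Submodule.Quotient.mk_eq_zero _).2 hmem)
    obtain ⟨ρ, hρ, rfl⟩ := (hmemS q).1 hq
    rw [hpush, hsmul, hsub] at h2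
    obtain ⟨σ, hσ, hσe⟩ := (hmemP _).1 h2
    have hσe' : σ = residueMap f v ρ - ev • ρ := ofResidues_injective hσe
    obtain ⟨b, hb, hbP⟩ : ∃ b, ρ b ≠ 0 ∧ b ∉ P := by
      by_contra! hcon
      exact h3 ((hmemP _).2 ⟨ρ, mem_residues.2 ⟨hcon, (mem_residues.1 hρ).2⟩, rfl⟩)
    have heq : ∀ b ∉ P, residueMap f v ρ b = ev * ρ b := by
      intro b hb
      have h4 : σ b = 0 := by
        by_contra hne
        exact hb ((mem_residues.1 hσ).1 b hne)
      rw [hσe'] at h4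
      exact sub_eq_zero.1 h4
    obtain ⟨h5, h6⟩ := arithmetic_of_pole_notMem hD hα hper hvP hPinv hev heq hbP hb
    refine ⟨h5, hhalf ev h6, ?_⟩
    by_cases hcase : ∀ τ ∈ residues P, residueMap f v τ = ev • τ → τ = 0
    · have := finiteDimensional_residues (finite_setOf_iterate_eq hv)
      obtain ⟨τ, hτ, hτe⟩ := exists_correction (residueMap f v) (residues P) hresP hcase
        (hσe' ▸ hσ)
      refine norm_lt_one_of_eigenvector hD hα hper hev (Submodule.sub_mem _ hρ (hle hτ)) ?_ hτe
      intro h0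
      have h7 : ρ = τ := sub_eq_zero.1 h0
      exact hbP ((mem_residues.1 hτ).1 b (h7 ▸ hb))
    · push Not at hcase
      obtain ⟨τ, hτ, hτe, hτ0⟩ := hcase
      exact (hpost ev τ hτ hτ0 hτe).2.2
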